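/- **Setting.** A root datum $\mathfrak T=(I,\cdot,Y,X,\langle\ ,\ \rangle,i_1,i_2)$ consists of a finite set $I$; a symmetric bilinear form $\cdot$ on $\mathbb Z[I]$ with $i\cdot i\in\{2,4,6,\dots\}$ and $C_{ij}:=2\frac{i\cdot j}{i\cdot i}\in\{0,-1,-2,\dots\}$ for $i\ne j$ (and $C_{ii}=2$); finitely generated free abelian groups $Y,X$ with a perfect pairing $\langle\ ,\ \rangle:Y\times X\to\mathbb Z$; and injections $i_1:I\to Y$, $i_2:I\to X$ with $\langle i_1(i),i_2(j)\rangle=C_{ij}$. A root datum $\mathfrak J=(J,\cdot',Y',X',\langle\ ,\ \rangle',i_1',i_2')$ is a sub-root datum of $\mathfrak T$ via an injective map $\iota:J\to I$, written $\mathfrak J\subseteq_\iota\mathfrak T$, if the form $\cdot$ restricts to $\cdot'$ along $\iota$ and there are injective homomorphisms $s_Y:Y'\to Y$, $s_X:X'\to X$ such that $Y/s_Y(Y')$ and $X/s_X(X')$ are free abelian, $\langle s_Y(y),s_X(x)\rangle=\langle y,x\rangle'$, there is a subgroup $X''$ with $X=s_X(X')\oplus X''$ and $\langle s_Y(Y'),X''\rangle=0$,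 and $s_Y i_1'=i_1\iota$, $s_X i_2'=i_2\iota$. Let $k$ be a field of arbitrary characteristic and let $q\in k^*$ not be a root of unity. Put $c_i=\frac{i\cdot i}{2}$, $q_i=q^{c_i}$ and $Z=\mathbb Z[i_1(I)]\subseteq Y$ (the subgroup generated by $i_1(I)$). Let $U_q(\mathfrak T)$ be the Hopf algebra over $k$ generated by $E_i,F_i$ $(i\in I)$ and $K_\mu$ $(\mu\in Z)$ with relations $K_0=1$, $K_\mu K_\nu=K_{\mu+\nu}$, $K_\mu E_i=q^{\langle\mu,i_2(i)\rangle}E_iK_\mu$, $K_\mu F_i=q^{-\langle\mu,i_2(i)\rangle}F_iK_\mu$, $E_iF_j-F_jE_i=\delta_{ij}\frac{H_i-H_i^{-1}}{q_i-q_i^{-1}}$ with $H_i=K_{i_1(i)}^{c_i}$, and, for $i\neq j$, the quantum Serre relations $$\sum_{m=0}^{1-C_{ij}}(-1)^m\begin{bmatrix}1-C_{ij}\\ m\end{bmatrix}_{q_i}x_i^{1-C_{ij}-m}x_jx_i^m=0\qquad(x=E\text{ and }x=F),$$ where the coefficients are symmetric $q_i$-binomials. The coproduct is $\Delta E_i=E_i\otimes1+H_i\otimes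 E_i$, $\Delta F_i=F_i\otimes H_i^{-1}+1\otimes F_i$, $\Delta K_\mu=K_\mu\otimes K_\mu$. Let $H=U_q^{\leqslant}(\mathfrak T)$ be the sub-Hopf algebra of $U_q(\mathfrak T)$ generated by all $F_i$ and $K_\mu$. With $D=I\setminus\iota(J)$, it is $\mathbb N$-graded, $H=\bigoplus_{n\ge0}H_n$, by $\deg F_i=1$ if $i\in D$, $\deg F_i=0$ if $i\notin D$, and $\deg K_\mu=0$. Let $\pi:H\to H_0$ be the projection that is the identity on $H_0$ and zero on $H_n$ for $n>0$. The graded braided Hopf algebra $B=B(\mathfrak T,\mathfrak J,\iota,q)$ attached to $\mathfrak J\subseteq_\iota\mathfrak T$ has as underlying graded algebra the algebra of coinvariants $$B=\{b\in H\mid b_{(1)}\otimes\pi(b_{(2)})=b\otimes1\},\qquad B_n=B\cap H_n .$$ The index of $\mathfrak J$ in $\mathfrak T$ is $|\mathfrak T:\mathfrak J|_q:=\dim_k B_1$. **Lemma.** Let $\mathfrak J\subseteq_\iota\mathfrak T$ be a sub-root datum. Then every homogeneous component $B_n$ $(n\ge0)$ of $B=B(\mathfrak T,\mathfrak J,\iota,q)$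 is finite-dimensional over $k$ if and only if the index $|\mathfrak T:\mathfrak J|_q$ is finite. -/

import Mathlib

open scoped TensorProduct

namespace QEA

section QNumbers
variable {k : Type*} [Field k]

/-- The symmetric `v`-integer `[a]`. -/
noncomputable def qInt (v : kˣ) (a : ℕ) : k :=
  (((v ^ a : kˣ) : k) - ((v ^ a)⁻¹ : kˣ)) / ((v : k) - (v⁻¹ : kˣ))

/-- The symmetric `v`-factorial `[n]! = [1][2]⋯[n]`. -/
noncomputable def qFactorial (v : kˣ) (n : ℕ) : k :=
  ∏ r ∈ Finset.range n, qInt v (r + 1)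

/-- The symmetric `v`-binomial coefficient `[n]! / ([m]! [n - m]!)`, zero for `m > n`. -/
noncomputable def qBinom (v : kˣ) (n m : ℕ) : k :=
  if m ≤ n then qFactorial v n / (qFactorial v m * qFactorial v (n - m)) else 0

/-- The quantum Serre expression `∑ₘ (-1)ᵐ [n choose m] xⁿ⁻ᵐ y xᵐ`. -/
noncomputable def qSerre {A : Type*} [Ring A] [Algebra k A] (v : kˣ) (n : ℕ) (x y : A) : A :=
  ∑ m ∈ Finset.range (n + 1), ((-1) ^ m * qBinom v n m) • (x ^ (n - m) * y * x ^ m)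

end QNumbers

section QNumberLemmas
variable {k : Type*} [Field k] {v : kˣ}

/-- `v` is not a root of unity. -/
def NotRootOfUnity (v : kˣ) : Prop := ∀ n : ℕ, n ≠ 0 → v ^ n ≠ 1

theorem NotRootOfUnity.pow {v : kˣ} (hv : NotRootOfUnity v) {c : ℕ} (hc : c ≠ 0) :
    NotRootOfUnity (v ^ c) := fun n hn => by
  rw [← pow_mul]; exact hv _ (Nat.mul_ne_zero hc hn)

theorem NotRootOfUnity.sub_inv_ne_zero (hv : NotRootOfUnity v) {a : ℕ} (ha : a ≠ 0) :
    (((v ^ a : kˣ) : k) - ((v ^ a)⁻¹ : kˣ)) ≠ 0 := by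
  intro h
  rw [sub_eq_zero, Units.val_inj] at h
  apply hv (a + a) (by omega)
  rw [pow_add]; nth_rw 1 [h]; simp

theorem qInt_ne_zero (hv : NotRootOfUnity v) {a : ℕ} (ha : a ≠ 0) : qInt v a ≠ 0 := by
  unfold qInt
  refine div_ne_zero (hv.sub_inv_ne_zero ha) ?_
  simpa using hv.sub_inv_ne_zero one_ne_zero

theorem qFactorial_ne_zero (hv : NotRootOfUnity v) (n : ℕ) : qFactorial v n ≠ 0 :=
  Finset.prod_ne_zero_iff.2 fun r _ => qInt_ne_zero hv (by omega)

theorem qFactorial_succ (v : kˣ) (n : ℕ) :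
    qFactorial v (n + 1) = qFactorial v n * qInt v (n + 1) := Finset.prod_range_succ _ _

theorem qBinom_zero_right (hv : NotRootOfUnity v) (n : ℕ) : qBinom v n 0 = 1 := by
  have := qFactorial_ne_zero hv n
  simp [qBinom, qFactorial] at *; exact this

theorem qBinom_self (hv : NotRootOfUnity v) (n : ℕ) : qBinom v n n = 1 := by
  have := qFactorial_ne_zero hv n
  simp [qBinom, qFactorial] at *; exact this

theorem qBinom_eq_zero {n m : ℕ} (h : n < m) : qBinom v n m = 0 := by
  simp [qBinom, h]

theorem qBinom_symm {n m : ℕ} (h : m ≤ n) : qBinom v n (n - m) = qBinom v n m := by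
  simp [qBinom, h, Nat.sub_sub_self h, mul_comm]

theorem qInt_inv (v : kˣ) (a : ℕ) : qInt v⁻¹ a = qInt v a := by
  simp only [qInt, inv_pow, inv_inv]
  rw [← neg_sub, ← neg_sub (v : k), neg_div_neg_eq]

theorem qBinom_inv (v : kˣ) (n m : ℕ) : qBinom v⁻¹ n m = qBinom v n m := by
  simp [qBinom, qFactorial, qInt_inv]

theorem NotRootOfUnity.inv (hv : NotRootOfUnity v) : NotRootOfUnity v⁻¹ := fun n hn => by
  simpa using hv n hn

theorem qInt_add (hv : NotRootOfUnity v) (a b : ℕ) :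
    qInt v (a + b) = (v : k) ^ a * qInt v b + ((v : k) ^ b)⁻¹ * qInt v a := by
  have h := hv.sub_inv_ne_zero one_ne_zero
  simp only [pow_one] at h
  unfold qInt
  have hk : (v : k) ≠ 0 := v.ne_zero
  rw [div_eq_iff h, add_mul, mul_assoc, mul_assoc, div_mul_cancel₀ _ h, div_mul_cancel₀ _ h]
  simp only [pow_add, Units.val_inv_eq_inv_val, Units.val_mul, Units.val_pow_eq_pow_val]
  field_simp
  ring

/-- Pascal rule for symmetric `v`-binomials. -/
theorem qBinom_pascal (hv : NotRootOfUnity v) (s m : ℕ) :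
    qBinom v (s + 1) (m + 1) =
      ((v ^ ((m : ℤ) + 1) : kˣ) : k) * qBinom v s (m + 1) +
        ((v ^ ((m : ℤ) - s) : kˣ) : k) * qBinom v s m := by
  rcases lt_trichotomy m s with h | rfl | h
  · obtain ⟨d, rfl⟩ := Nat.exists_eq_add_of_lt h
    have e1 : m + d + 1 + 1 - (m + 1) = d + 1 := by omega
    have e2 : m + d + 1 - (m + 1) = d := by omega
    have e3 : m + d + 1 - m = d + 1 := by omega
    simp only [qBinom, if_pos (show m + 1 ≤ m + d + 1 + 1 by omega),
      if_pos (show m + 1 ≤ m + d + 1 by omega), if_pos (show m ≤ m + d + 1 by omega), e1, e2, e3]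
    rw [qFactorial_succ v (m + d + 1), qFactorial_succ v m, qFactorial_succ v d,
      show m + d + 1 + 1 = (m + 1) + (d + 1) by omega, qInt_add hv (m + 1) (d + 1)]
    have a1 := qFactorial_ne_zero hv m
    have a2 := qFactorial_ne_zero hv d
    have a3 := qInt_ne_zero hv (Nat.succ_ne_zero m)
    have a4 := qInt_ne_zero hv (Nat.succ_ne_zero d)
    have hk : (v : k) ≠ 0 := v.ne_zero
    have z1 : ((v ^ ((m : ℤ) + 1) : kˣ) : k) = (v : k) ^ (m + 1) := by
      rw [show ((m : ℤ) + 1) = ((m + 1 : ℕ) : ℤ) by push_cast; ring, zpow_natCast,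
        Units.val_pow_eq_pow_val]
    have z2 : ((v ^ ((m : ℤ) - ((m + d + 1 : ℕ) : ℤ)) : kˣ) : k) = ((v : k) ^ (d + 1))⁻¹ := by
      rw [show ((m : ℤ) - ((m + d + 1 : ℕ) : ℤ)) = -((d + 1 : ℕ) : ℤ) by push_cast; ring, zpow_neg,
        zpow_natCast, Units.val_inv_eq_inv_val, Units.val_pow_eq_pow_val]
    rw [z1, z2]
    simp only [Nat.succ_eq_add_one] at a3 a4
    field_simp
  · simp [qBinom_self hv, qBinom_eq_zero (Nat.lt_succ_self m)]
  · simp [qBinom_eq_zero h, qBinom_eq_zero (show s < m + 1 by omega),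
      qBinom_eq_zero (show s + 1 < m + 1 by omega)]

/-- The other Pascal rule. -/
theorem qBinom_pascal' (hv : NotRootOfUnity v) (s m : ℕ) :
    qBinom v (s + 1) (m + 1) =
      ((v ^ (-((m : ℤ) + 1)) : kˣ) : k) * qBinom v s (m + 1) +
        ((v ^ ((s : ℤ) - m) : kˣ) : k) * qBinom v s m := by
  have := qBinom_pascal hv.inv s m
  simp only [qBinom_inv, inv_zpow', neg_sub] at this
  exact this

end QNumberLemmas

section Serre
variable {k : Type*} [Field k] {A : Type*} [Ring A] [Algebra k A]

/-- Iterated `v`-commutators. -/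
noncomputable def qAd (v : kˣ) (e : ℤ) (x z : A) : ℕ → A
  | 0 => z
  | s + 1 => x * qAd v e x z s - ((v ^ (-(e + 2 * s)) : kˣ) : k) • (qAd v e x z s * x)

theorem qAd_eq_sum {v : kˣ} (hv : NotRootOfUnity v) (e : ℤ) (x z : A) (s : ℕ) :
    qAd v e x z s = ∑ m ∈ Finset.range (s + 1),
      ((-1) ^ m * qBinom v s m * ((v ^ (-(m * (e + s - 1)) : ℤ) : kˣ) : k)) •
        (x ^ (s - m) * z * x ^ m) := by
  induction s with
  | zero => simp [qAd, qBinom_self hv]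
  | succ s ih =>
    rw [qAd, ih, Finset.sum_range_succ' _ (s + 1)]
    have h1 : x * ∑ m ∈ Finset.range (s + 1),
        ((-1) ^ m * qBinom v s m * ((v ^ (-(m * (e + s - 1)) : ℤ) : kˣ) : k)) •
          (x ^ (s - m) * z * x ^ m) =
        (∑ m ∈ Finset.range (s + 1),
        ((-1) ^ (m + 1) * qBinom v s (m + 1) *
          ((v ^ (-((m + 1 : ℕ) * (e + s - 1)) : ℤ) : kˣ) : k)) •
          (x ^ (s - m) * z * x ^ (m + 1))) + x ^ (s + 1) * z := by
      rw [Finset.sum_range_succ', Finset.sum_range_succ, mul_add, Finset.mul_sum]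
      simp only [qBinom_eq_zero (Nat.lt_succ_self s), mul_zero, zero_mul, zero_smul, add_zero]
      congr 1
      · apply Finset.sum_congr rfl
        intro m hm
        rw [Finset.mem_range] at hm
        rw [mul_smul_comm, show s - m = s - (m + 1) + 1 by omega, pow_succ' x (s - (m + 1))]
        simp only [mul_assoc]
      · simp [qBinom_zero_right hv, pow_succ', mul_assoc]
    rw [h1, Finset.sum_mul, Finset.smul_sum, add_sub_right_comm, ← Finset.sum_sub_distrib]
    congr 1
    · apply Finset.sum_congr rfl
      intro m hm
      rw [show s + 1 - (m + 1) = s - m by omega, smul_mul_assoc, smul_smul, mul_assoc _ _ x,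
        ← pow_succ, ← sub_smul, qBinom_pascal hv]
      congr 1
      have e1 : v ^ (-(((m + 1 : ℕ) : ℤ) * (e + s - 1))) =
          v ^ ((m : ℤ) + 1) * v ^ (-(((m + 1 : ℕ) : ℤ) * (e + (s + 1 : ℕ) - 1))) := by
        rw [← zpow_add]; congr 1; push_cast; ring
      have e2 : v ^ (-(e + 2 * s)) * v ^ (-((m : ℤ) * (e + s - 1))) =
          v ^ ((m : ℤ) - s) * v ^ (-(((m + 1 : ℕ) : ℤ) * (e + (s + 1 : ℕ) - 1))) := by
        rw [← zpow_add, ← zpow_add]; congr 1; push_cast; ring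
      have e2' := congrArg (Units.val) e2
      simp only [Units.val_mul] at e2'
      rw [e1, Units.val_mul]
      linear_combination (-(-1) ^ m * qBinom v s m) * e2'
    · simp [qBinom_zero_right hv]

theorem qSerre_eq_qAd {v : kˣ} (hv : NotRootOfUnity v) {e : ℤ} {n : ℕ} (hn : (n : ℤ) = 1 - e)
    (x z : A) : qSerre v n x z = qAd v e x z n := by
  rw [qAd_eq_sum hv, qSerre]
  refine Finset.sum_congr rfl fun m _ => ?_
  rw [show (-(m * (e + n - 1)) : ℤ) = 0 by rw [hn]; ring]
  simp

/-- Coefficients in the expansion of `qAd` of a sum. -/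
noncomputable def qCoeff (v : kˣ) (e : ℤ) (s t : ℕ) : k :=
  qBinom v s t * ((v ^ ((t : ℤ) * (s - t)) : kˣ) : k) *
    ∏ r ∈ Finset.Ico t s, (((v ^ e : kˣ) : k) - ((v ^ (-e - 2 * r) : kˣ) : k))

theorem qCoeff_self {v : kˣ} (hv : NotRootOfUnity v) (e : ℤ) (s : ℕ) : qCoeff v e s s = 1 := by
  simp [qCoeff, qBinom_self hv]

theorem qCoeff_of_lt {v : kˣ} (e : ℤ) {s t : ℕ} (h : s < t) : qCoeff v e s t = 0 := by
  simp [qCoeff, qBinom_eq_zero h]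

theorem qCoeff_top {v : kˣ} {e : ℤ} {n t : ℕ} (hn : (n : ℤ) = 1 - e) (h : t < n) :
    qCoeff v e n t = 0 := by
  unfold qCoeff
  rw [Finset.prod_eq_zero (i := n - 1), mul_zero]
  · simp; omega
  · rw [show -e - 2 * ((n - 1 : ℕ) : ℤ) = e by omega, sub_self]

theorem qCoeff_zero_right {v : kˣ} (hv : NotRootOfUnity v) (e : ℤ) (s : ℕ) :
    qCoeff v e (s + 1) 0 =
      (((v ^ e : kˣ) : k) - ((v ^ (-e - 2 * s) : kˣ) : k)) * qCoeff v e s 0 := by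
  unfold qCoeff
  rw [Finset.prod_Ico_succ_top (Nat.zero_le s)]
  simp [qBinom_zero_right hv, mul_comm]

theorem qCoeff_succ {v : kˣ} (hv : NotRootOfUnity v) (e : ℤ) (s t : ℕ) :
    qCoeff v e (s + 1) (t + 1) =
      (((v ^ (2 * ((t + 1 : ℕ) : ℤ) + e) : kˣ) : k) - ((v ^ (-e - 2 * s) : kˣ) : k)) *
        qCoeff v e s (t + 1) + qCoeff v e s t := by
  rcases lt_trichotomy t s with h | rfl | h
  · have hP : ∏ r ∈ Finset.Ico t s, (((v ^ e : kˣ) : k) - ((v ^ (-e - 2 * r) : kˣ) : k)) =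
        (((v ^ e : kˣ) : k) - ((v ^ (-e - 2 * t) : kˣ) : k)) *
        ∏ r ∈ Finset.Ico (t + 1) s, (((v ^ e : kˣ) : k) - ((v ^ (-e - 2 * r) : kˣ) : k)) :=
      Finset.prod_eq_prod_Ico_succ_bot h _
    unfold qCoeff
    rw [hP, Finset.prod_Ico_succ_top (by omega)]
    set P := ∏ r ∈ Finset.Ico (t + 1) s, (((v ^ e : kˣ) : k) - ((v ^ (-e - 2 * r) : kˣ) : k))
    have p1 := qBinom_pascal hv s t
    have p2 := qBinom_pascal' hv s t
    have hk : (v : k) ≠ 0 := v.ne_zero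
    -- multiply the Pascal rules by suitable powers
    have key1 : qBinom v (s + 1) (t + 1) *
        ((v ^ (((t + 1 : ℕ) : ℤ) * ((s + 1 : ℕ) - (t + 1 : ℕ))) : kˣ) : k) * ((v ^ e : kˣ) : k) =
        ((v ^ (2 * ((t + 1 : ℕ) : ℤ) + e) : kˣ) : k) * (qBinom v s (t + 1) *
          ((v ^ (((t + 1 : ℕ) : ℤ) * (s - (t + 1 : ℕ))) : kˣ) : k)) +
        qBinom v s t * ((v ^ ((t : ℤ) * (s - t)) : kˣ) : k) * ((v ^ e : kˣ) : k) := by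
      rw [p1]
      simp only [Units.val_zpow_eq_zpow_val]
      have a1 : (v : k) ^ ((t : ℤ) + 1) *
          (v : k) ^ (((t + 1 : ℕ) : ℤ) * ((s + 1 : ℕ) - (t + 1 : ℕ))) * (v : k) ^ e =
          (v : k) ^ (2 * ((t + 1 : ℕ) : ℤ) + e) *
            (v : k) ^ (((t + 1 : ℕ) : ℤ) * (s - (t + 1 : ℕ))) := by
        simp only [← zpow_add₀ hk]; congr 1; push_cast; ring
      have a2 : (v : k) ^ ((t : ℤ) - s) *
          (v : k) ^ (((t + 1 : ℕ) : ℤ) * ((s + 1 : ℕ) - (t + 1 : ℕ))) =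
          (v : k) ^ ((t : ℤ) * (s - t)) := by
        simp only [← zpow_add₀ hk]; congr 1; push_cast; ring
      linear_combination qBinom v s (t + 1) * a1 + qBinom v s t * (v : k) ^ e * a2
    have key2 : qBinom v (s + 1) (t + 1) *
        ((v ^ (((t + 1 : ℕ) : ℤ) * ((s + 1 : ℕ) - (t + 1 : ℕ))) : kˣ) : k) *
          ((v ^ (-e - 2 * s) : kˣ) : k) =
        ((v ^ (-e - 2 * s) : kˣ) : k) * (qBinom v s (t + 1) *
          ((v ^ (((t + 1 : ℕ) : ℤ) * (s - (t + 1 : ℕ))) : kˣ) : k)) +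
        qBinom v s t * ((v ^ ((t : ℤ) * (s - t)) : kˣ) : k) * ((v ^ (-e - 2 * t) : kˣ) : k) := by
      rw [p2]
      simp only [Units.val_zpow_eq_zpow_val]
      have a1 : (v : k) ^ (-((t : ℤ) + 1)) *
          (v : k) ^ (((t + 1 : ℕ) : ℤ) * ((s + 1 : ℕ) - (t + 1 : ℕ))) =
            (v : k) ^ (((t + 1 : ℕ) : ℤ) * (s - (t + 1 : ℕ))) := by
        simp only [← zpow_add₀ hk]; congr 1; push_cast; ring
      have a2 : (v : k) ^ ((s : ℤ) - t) *
          (v : k) ^ (((t + 1 : ℕ) : ℤ) * ((s + 1 : ℕ) - (t + 1 : ℕ))) * (v : k) ^ (-e - 2 * s) =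
          (v : k) ^ ((t : ℤ) * (s - t)) * (v : k) ^ (-e - 2 * t) := by
        simp only [← zpow_add₀ hk]; congr 1; push_cast; ring
      linear_combination qBinom v s (t + 1) * (v : k) ^ (-e - 2 * s) * a1 + qBinom v s t * a2
    linear_combination P * key1 - P * key2
  · rw [qCoeff_self hv, qCoeff_self hv, qCoeff_of_lt _ (Nat.lt_succ_self t)]; ring
  · rw [qCoeff_of_lt _ h, qCoeff_of_lt _ (show s < t + 1 by omega),
      qCoeff_of_lt _ (show s + 1 < t + 1 by omega)]; ring

theorem qAd_add {v : kˣ} (hv : NotRootOfUnity v) (e : ℤ) {x y z w : A}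
    (hxy : x * y = ((v ^ (2 : ℤ) : kˣ) : k) • (y * x))
    (hzy : z * y = ((v ^ e : kˣ) : k) • (y * z))
    (hxw : x * w = ((v ^ e : kˣ) : k) • (w * x)) (s : ℕ) :
    qAd v e (x + y) (z + w) s = qAd v e x z s +
      ∑ t ∈ Finset.range (s + 1), qCoeff v e s t • (qAd v e y w t * x ^ (s - t)) := by
  have hz : ∀ s : ℕ, qAd v e x z s * y =
      ((v ^ (e + 2 * s) : kˣ) : k) • (y * qAd v e x z s) := by
    intro s
    induction s with
    | zero => simpa [qAd] using hzy
    | succ s ih =>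
      rw [qAd, sub_mul, mul_assoc, ih, smul_mul_assoc, mul_assoc _ x y, hxy, mul_smul_comm,
        mul_smul_comm, ← mul_assoc, hxy, smul_mul_assoc, ← mul_assoc, ih, smul_mul_assoc,
        mul_sub, mul_smul_comm, smul_sub]
      simp only [smul_smul, ← Units.val_mul, ← zpow_add, mul_assoc]
      congr 3
      · congr 1; push_cast; ring
      · congr 1; push_cast; ring
  have hw : ∀ t : ℕ, x * qAd v e y w t =
      ((v ^ (e + 2 * t) : kˣ) : k) • (qAd v e y w t * x) := by
    intro t
    induction t with
    | zero => simpa [qAd] using hxw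
    | succ t ih =>
      rw [qAd, mul_sub, ← mul_assoc, hxy, smul_mul_assoc, mul_assoc, ih, mul_smul_comm,
        mul_smul_comm, ← mul_assoc, ← mul_assoc, ih, smul_mul_assoc, mul_assoc _ x y, hxy,
        mul_smul_comm, sub_mul, smul_mul_assoc, smul_sub]
      simp only [smul_smul, ← Units.val_mul, ← zpow_add, mul_assoc]
      congr 3
      · congr 1; push_cast; ring
      · congr 1; push_cast; ring
  have hp : ∀ a : ℕ, x ^ a * y = ((v ^ (2 * (a : ℤ)) : kˣ) : k) • (y * x ^ a) := by
    intro a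
    induction a with
    | zero => simp
    | succ a ih =>
      rw [pow_succ, mul_assoc, hxy, mul_smul_comm, ← mul_assoc, ih, smul_mul_assoc, smul_smul,
        ← Units.val_mul, ← zpow_add, mul_assoc]
      congr 3; push_cast; ring
  induction s with
  | zero => simp [qAd, qCoeff_self hv]
  | succ s ih =>
    have step1 : y * qAd v e x z s -
        ((v ^ (-(e + 2 * s)) : kˣ) : k) • (qAd v e x z s * y) = 0 := by
      rw [hz, smul_smul, ← Units.val_mul, ← zpow_add]; simp
    have step2 : ∀ t ∈ Finset.range (s + 1),
        (x + y) * (qAd v e y w t * x ^ (s - t)) - ((v ^ (-(e + 2 * s)) : kˣ) : k) •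
          ((qAd v e y w t * x ^ (s - t)) * (x + y)) =
        (((v ^ (2 * (t : ℤ) + e) : kˣ) : k) - ((v ^ (-e - 2 * s) : kˣ) : k)) •
          (qAd v e y w t * x ^ (s + 1 - t)) + qAd v e y w (t + 1) * x ^ (s - t) := by
      intro t ht
      rw [Finset.mem_range] at ht
      obtain ⟨a, rfl⟩ : ∃ a, s = t + a := ⟨s - t, by omega⟩
      have h1 : t + a - t = a := by omega
      have h2 : t + a + 1 - t = a + 1 := by omega
      rw [h1, h2, add_mul, ← mul_assoc x, hw, mul_add, mul_assoc _ (x ^ a) y, hp, mul_assoc _ _ x,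
        ← pow_succ, smul_mul_assoc, mul_assoc _ x, ← pow_succ', qAd, sub_mul, smul_mul_assoc,
        mul_smul_comm, smul_add, smul_smul, ← Units.val_mul, ← zpow_add]
      have q1 : -(e + 2 * ((t + a : ℕ) : ℤ)) + 2 * (a : ℤ) = -(e + 2 * t) := by push_cast; ring
      have q2 : -e - 2 * ((t + a : ℕ) : ℤ) = -(e + 2 * ((t + a : ℕ) : ℤ)) := by ring
      rw [q1, q2, add_comm (2 * (t : ℤ)) e]
      simp only [mul_assoc]
      module
    have expand : qAd v e (x + y) (z + w) (s + 1) = qAd v e x z (s + 1) +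
        (y * qAd v e x z s - ((v ^ (-(e + 2 * s)) : kˣ) : k) • (qAd v e x z s * y)) +
        ∑ t ∈ Finset.range (s + 1), qCoeff v e s t •
          ((x + y) * (qAd v e y w t * x ^ (s - t)) - ((v ^ (-(e + 2 * s)) : kˣ) : k) •
          ((qAd v e y w t * x ^ (s - t)) * (x + y))) := by
      rw [qAd, ih]
      set S := ∑ t ∈ Finset.range (s + 1), qCoeff v e s t • (qAd v e y w t * x ^ (s - t)) with hS
      have : ∑ t ∈ Finset.range (s + 1), qCoeff v e s t •
          ((x + y) * (qAd v e y w t * x ^ (s - t)) - ((v ^ (-(e + 2 * s)) : kˣ) : k) •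
          ((qAd v e y w t * x ^ (s - t)) * (x + y))) =
          (x + y) * S - ((v ^ (-(e + 2 * s)) : kˣ) : k) • (S * (x + y)) := by
        rw [hS, Finset.mul_sum, Finset.sum_mul, Finset.smul_sum, ← Finset.sum_sub_distrib]
        refine Finset.sum_congr rfl fun t _ => ?_
        rw [smul_sub, mul_smul_comm, smul_mul_assoc, smul_comm (qCoeff v e s t)]
      rw [this, qAd]
      simp only [mul_add, add_mul, smul_add]
      abel
    rw [expand, step1, add_zero]
    congr 1
    rw [Finset.sum_congr rfl fun t ht => congrArg (qCoeff v e s t • ·) (step2 t ht)]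
    simp only [smul_add, Finset.sum_add_distrib]
    rw [Finset.sum_range_succ' _ (s + 1)]
    simp only [qCoeff_succ hv, qCoeff_zero_right hv, add_smul, Finset.sum_add_distrib]
    have : ∑ t ∈ Finset.range (s + 1), qCoeff v e s t •
        (((v ^ (2 * (t : ℤ) + e) : kˣ) : k) - ((v ^ (-e - 2 * s) : kˣ) : k)) •
          (qAd v e y w t * x ^ (s + 1 - t)) =
        ∑ t ∈ Finset.range (s + 1 + 1), qCoeff v e s t •
        (((v ^ (2 * (t : ℤ) + e) : kˣ) : k) - ((v ^ (-e - 2 * s) : kˣ) : k)) •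
          (qAd v e y w t * x ^ (s + 1 - t)) := by
      rw [Finset.sum_range_succ _ (s + 1), qCoeff_of_lt _ (Nat.lt_succ_self s), zero_smul, add_zero]
    rw [this, Finset.sum_range_succ' _ (s + 1)]
    simp only [smul_smul, Nat.cast_zero, mul_zero, zero_add, Nat.succ_sub_succ]
    rw [add_right_comm]
    congr 1
    · congr 1
      refine Finset.sum_congr rfl fun t _ => ?_
      rw [mul_comm]
    · rw [mul_comm]

/-- The quantum Serre expression is additive on suitably `v`-commuting pairs. -/
theorem qSerre_add {v : kˣ} (hv : NotRootOfUnity v) {e : ℤ} {n : ℕ} (hn : (n : ℤ) = 1 - e)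
    {x y z w : A}
    (hxy : x * y = ((v ^ (2 : ℤ) : kˣ) : k) • (y * x))
    (hzy : z * y = ((v ^ e : kˣ) : k) • (y * z))
    (hxw : x * w = ((v ^ e : kˣ) : k) • (w * x)) :
    qSerre v n (x + y) (z + w) = qSerre v n x z + qSerre v n y w := by
  rw [qSerre_eq_qAd hv hn, qSerre_eq_qAd hv hn, qSerre_eq_qAd hv hn, qAd_add hv e hxy hzy hxw,
    Finset.sum_range_succ, Finset.sum_eq_zero, qCoeff_self hv]
  · simp
  · intro t ht
    rw [qCoeff_top hn (Finset.mem_range.1 ht), zero_smul]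

theorem qSerre_smul (v : kˣ) (n : ℕ) (c d : k) (x z : A) :
    qSerre v n (c • x) (d • z) = (c ^ n * d) • qSerre v n x z := by
  unfold qSerre
  rw [Finset.smul_sum]
  refine Finset.sum_congr rfl fun m hm => ?_
  have : n = (n - m) + m := by have := Finset.mem_range.1 hm; omega
  simp only [smul_pow, smul_mul_assoc, mul_smul_comm, smul_smul]
  congr 1
  have hc : c ^ n = c ^ (n - m) * c ^ m := by rw [← pow_add, ← this]
  rw [hc]; ring

theorem qSerre_zero (v : kˣ) (n : ℕ) (x : A) : qSerre v n x 0 = 0 := by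
  simp [qSerre]

theorem qSerre_map {B : Type*} [Ring B] [Algebra k B] (f : A →ₐ[k] B) (v : kˣ) (n : ℕ) (x z : A) :
    f (qSerre v n x z) = qSerre v n (f x) (f z) := by
  simp [qSerre]

theorem qSerre_op (v : kˣ) (n : ℕ) (x z : A) :
    qSerre v n (MulOpposite.op x) (MulOpposite.op z) =
      (-1 : k) ^ n • MulOpposite.op (qSerre v n x z) := by
  unfold qSerre
  rw [← Finset.sum_range_reflect, Finset.op_sum, Finset.smul_sum]
  refine Finset.sum_congr rfl fun m hm => ?_
  have hm' : m ≤ n := by have := Finset.mem_range.1 hm; omega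
  rw [show n + 1 - 1 - m = n - m by omega, qBinom_symm hm', Nat.sub_sub_self hm',
    MulOpposite.op_smul, smul_smul]
  simp only [← MulOpposite.op_pow, ← MulOpposite.op_mul, mul_assoc]
  congr 1
  rw [← mul_assoc, ← pow_add]
  congr 1
  have h1 : n + m = (n - m) + 2 * m := by omega
  rw [h1, pow_add, pow_mul]; simp

/-- Twisting the arguments of the quantum Serre expression by elements `a`, `b`. -/
theorem qSerre_twist {v : kˣ} (hv : NotRootOfUnity v) {e : ℤ} {n : ℕ} (hn : (n : ℤ) = 1 - e)
    {x z a b : A} (hab : a * b = b * a)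
    (hxa : x * a = ((v ^ (-2 : ℤ) : kˣ) : k) • (a * x))
    (hza : z * a = ((v ^ (-e) : kˣ) : k) • (a * z))
    (hxb : x * b = ((v ^ (-e) : kˣ) : k) • (b * x)) :
    ∃ c : k, qSerre v n (a * x) (b * z) = c • (a ^ n * b * qSerre v n x z) := by
  have hz : ∀ s : ℕ, qAd v e x z s * a =
      ((v ^ (-(e + 2 * s)) : kˣ) : k) • (a * qAd v e x z s) := by
    intro s
    induction s with
    | zero => simpa [qAd] using hza
    | succ s ih =>
      rw [qAd, sub_mul, mul_assoc, ih, smul_mul_assoc, mul_assoc _ x a, hxa, mul_smul_comm,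
        mul_smul_comm, ← mul_assoc, hxa, smul_mul_assoc, ← mul_assoc, ih, smul_mul_assoc,
        mul_sub, mul_smul_comm, smul_sub]
      simp only [smul_smul, ← Units.val_mul, ← zpow_add, mul_assoc]
      congr 3
      · congr 1; push_cast; ring
      · congr 1; push_cast; ring
  have hp : ∀ s : ℕ, x * a ^ s = ((v ^ (-2 * (s : ℤ)) : kˣ) : k) • (a ^ s * x) := by
    intro s
    induction s with
    | zero => simp
    | succ s ih =>
      rw [pow_succ, ← mul_assoc, ih, smul_mul_assoc, mul_assoc, hxa, mul_smul_comm, smul_smul,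
        ← Units.val_mul, ← zpow_add, mul_assoc]
      congr 3; push_cast; ring
  have hc : ∀ s : ℕ, a ^ s * b = b * a ^ s := fun s => (Commute.pow_left hab s)
  have main : ∀ s : ℕ, ∃ c : k,
      qAd v e (a * x) (b * z) s = c • (a ^ s * b * qAd v e x z s) := by
    intro s
    induction s with
    | zero => exact ⟨1, by simp [qAd]⟩
    | succ s ih =>
      obtain ⟨c, hc'⟩ := ih
      refine ⟨c * ((v ^ (-(e + 2 * s)) : kˣ) : k), ?_⟩
      have l1 : a * x * (a ^ s * b * qAd v e x z s) =
          ((v ^ (-(e + 2 * s)) : kˣ) : k) • (a ^ (s + 1) * b * (x * qAd v e x z s)) := by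
        calc a * x * (a ^ s * b * qAd v e x z s)
            = a * ((x * a ^ s) * b) * qAd v e x z s := by simp only [mul_assoc]
          _ = ((v ^ (-2 * (s : ℤ)) : kˣ) : k) • (a * (a ^ s * (x * b)) * qAd v e x z s) := by
              rw [hp]; simp only [smul_mul_assoc, mul_smul_comm, mul_assoc]
          _ = _ := by
              rw [hxb]
              simp only [smul_mul_assoc, mul_smul_comm, smul_smul, ← Units.val_mul, ← zpow_add,
                pow_succ', mul_assoc]
              congr 3; ring
      have l2 : a ^ s * b * qAd v e x z s * (a * x) =
          ((v ^ (-(e + 2 * s)) : kˣ) : k) • (a ^ (s + 1) * b * (qAd v e x z s * x)) := by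
        calc a ^ s * b * qAd v e x z s * (a * x)
            = a ^ s * b * (qAd v e x z s * a) * x := by simp only [mul_assoc]
          _ = ((v ^ (-(e + 2 * s)) : kˣ) : k) • (a ^ s * (b * a) * qAd v e x z s * x) := by
              rw [hz]; simp only [smul_mul_assoc, mul_smul_comm, mul_assoc]
          _ = _ := by rw [← hab]; simp only [pow_succ, mul_assoc]
      rw [qAd, hc', mul_smul_comm, smul_mul_assoc, l1, l2, qAd, mul_sub, mul_smul_comm]
      module
  obtain ⟨c, hc'⟩ := main n
  exact ⟨c, by rw [qSerre_eq_qAd hv hn, qSerre_eq_qAd hv hn, hc']⟩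

end Serre

/-- A Cartan datum on `I`: a symmetric bilinear form on `ℤ[I]` with `i · i ∈ {2, 4, 6, …}` and
`2 (i · j) / (i · i) ∈ {0, -1, -2, …}` for `i ≠ j`. -/
structure CartanDatum (I : Type*) where
  form : LinearMap.BilinForm ℤ (I →₀ ℤ)
  form_symm : ∀ x y, form x y = form y x
  form_self : ∀ i, ∃ c : ℕ, 0 < c ∧ form (Finsupp.single i 1) (Finsupp.single i 1) = 2 * (c : ℤ)
  form_dvd : ∀ i j, i ≠ j → form (Finsupp.single i 1) (Finsupp.single i 1) ∣
    2 * form (Finsupp.single i 1) (Finsupp.single j 1)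
  form_nonpos : ∀ i j, i ≠ j → form (Finsupp.single i 1) (Finsupp.single j 1) ≤ 0

namespace CartanDatum
variable {I : Type*} (T : CartanDatum I)

/-- `i · j`. -/
noncomputable def dot (i j : I) : ℤ := T.form (Finsupp.single i 1) (Finsupp.single j 1)

/-- The Cartan matrix `C i j = 2 (i · j) / (i · i)` (an exact division). -/
noncomputable def cartan (i j : I) : ℤ := 2 * T.dot i j / T.dot i i

/-- `c i = (i · i) / 2` (an exact division; a positive integer). -/
noncomputable def c (i : I) : ℕ := (T.dot i i / 2).toNat

theorem dot_comm (i j : I) : T.dot i j = T.dot j i := T.form_symm _ _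

theorem dot_self (i : I) : T.dot i i = 2 * (T.c i : ℤ) := by
  obtain ⟨c, -, hc⟩ := T.form_self i
  have : T.dot i i = 2 * (c : ℤ) := hc
  unfold CartanDatum.c
  omega

theorem c_ne_zero (i : I) : T.c i ≠ 0 := by
  obtain ⟨c, h0, hc⟩ := T.form_self i
  have : T.dot i i = 2 * (c : ℤ) := hc
  unfold CartanDatum.c
  omega

theorem c_mul_cartan (i j : I) : (T.c i : ℤ) * T.cartan i j = T.dot i j := by
  have h0 := T.c_ne_zero i
  have hs := T.dot_self i
  have hd : T.dot i i ∣ 2 * T.dot i j := by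
    by_cases h : i = j
    · subst h; exact Dvd.intro_left 2 rfl
    · exact T.form_dvd i j h
  have := Int.mul_ediv_cancel' hd
  unfold cartan
  rw [hs] at this ⊢
  linarith

theorem cartan_nonpos {i j : I} (h : i ≠ j) : T.cartan i j ≤ 0 := by
  have h1 := T.c_mul_cartan i j
  have h2 : T.dot i j ≤ 0 := T.form_nonpos i j h
  have h3 : (0 : ℤ) < T.c i := by have := T.c_ne_zero i; omega
  by_contra! h4
  have := mul_pos h3 h4
  omega

end CartanDatum

/-- A root datum `(I, ·, Y, X, ⟨ , ⟩, i₁, i₂)`. -/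
structure RootDatum (I Y X : Type*) [AddCommGroup Y] [AddCommGroup X] extends CartanDatum I where
  finite_index : Finite I
  free_Y : Module.Free ℤ Y
  finite_Y : Module.Finite ℤ Y
  free_X : Module.Free ℤ X
  finite_X : Module.Finite ℤ X
  pairing : Y →ₗ[ℤ] X →ₗ[ℤ] ℤ
  perfect : pairing.IsPerfPair
  i₁ : I ↪ Y
  i₂ : I ↪ X
  pairing_i₁_i₂ : ∀ i j, pairing (i₁ i) (i₂ j) = toCartanDatum.cartan i j

/-- `𝔍` is a sub-root datum of `𝔗` via `ι : J → I`. -/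
def IsSubRootDatum {I Y X J Y' X' : Type*} [AddCommGroup Y] [AddCommGroup X] [AddCommGroup Y']
    [AddCommGroup X'] (𝔍 : RootDatum J Y' X') (𝔗 : RootDatum I Y X) (ι : J → I) : Prop :=
  Function.Injective ι ∧
  (∀ x y : J →₀ ℤ, 𝔗.form (x.mapDomain ι) (y.mapDomain ι) = 𝔍.form x y) ∧
  ∃ (sY : Y' →+ Y) (sX : X' →+ X),
    Function.Injective sY ∧ Function.Injective sX ∧
    Module.Free ℤ (Y ⧸ sY.range) ∧ Module.Free ℤ (X ⧸ sX.range) ∧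
    (∀ y x, 𝔗.pairing (sY y) (sX x) = 𝔍.pairing y x) ∧
    (∃ X'' : AddSubgroup X, IsCompl sX.range X'' ∧ ∀ y, ∀ x ∈ X'', 𝔗.pairing (sY y) x = 0) ∧
    (∀ j, sY (𝔍.i₁ j) = 𝔗.i₁ (ι j)) ∧ (∀ j, sX (𝔍.i₂ j) = 𝔗.i₂ (ι j))

/-- A deformation parameter: an element of `kˣ` that is not a root of unity. -/
structure QParam (k : Type*) [Field k] where
  val : kˣ
  not_root : NotRootOfUnity val

namespace RootDatum
variable {I Y X : Type*} [AddCommGroup Y] [AddCommGroup X] (T : RootDatum I Y X)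

/-- The subgroup `Z = ℤ[i₁(I)]` of `Y`. -/
def Z : AddSubgroup Y := AddSubgroup.closure (Set.range T.i₁)

/-- `i₁(i)` as an element of `Z`. -/
def z (i : I) : T.Z := ⟨T.i₁ i, AddSubgroup.subset_closure ⟨i, rfl⟩⟩

/-- `⟨μ, i₂(i)⟩` for `μ ∈ Z`. -/
def wt (μ : T.Z) (i : I) : ℤ := T.pairing (μ : Y) (T.i₂ i)

theorem wt_cz (i j : I) : T.wt (T.c i • T.z i) j = T.dot i j := by
  simp [wt, z, T.pairing_i₁_i₂, T.c_mul_cartan]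

theorem wt_neg (μ : T.Z) (j : I) : T.wt (-μ) j = - T.wt μ j := by simp [wt]

theorem wt_zero (j : I) : T.wt 0 j = 0 := by simp [wt]

end RootDatum

section Uq
variable {k : Type*} [Field k] {I Y X : Type*} [AddCommGroup Y] [AddCommGroup X]

/-- The generators `E_i`, `F_i` (`i ∈ I`), `K_μ` (`μ ∈ Z`). -/
inductive UqGen (T : RootDatum I Y X) : Type _
  | E (i : I) : UqGen T
  | F (i : I) : UqGen T
  | K (μ : T.Z) : UqGen T

/-- The defining relations of `U_q(𝔗)`, for elements `e i`, `f i`, `κ μ` of a `k`-algebra. Here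
`q_i = q ^ c_i` and `H_i = K_{c_i i₁(i)}`, `H_i⁻¹ = K_{- c_i i₁(i)}`. -/
structure UqRelations (T : RootDatum I Y X) (q : QParam k) {A : Type*} [Ring A] [Algebra k A]
    (e f : I → A) (κ : T.Z → A) : Prop where
  K_zero : κ 0 = 1
  K_mul : ∀ μ ν, κ μ * κ ν = κ (μ + ν)
  K_E : ∀ μ i, κ μ * e i = ((q.val ^ T.wt μ i : kˣ) : k) • (e i * κ μ)
  K_F : ∀ μ i, κ μ * f i = ((q.val ^ (-T.wt μ i) : kˣ) : k) • (f i * κ μ)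
  E_F_self : ∀ i, e i * f i - f i * e i =
    (((q.val ^ T.c i : kˣ) : k) - ((q.val ^ T.c i)⁻¹ : kˣ))⁻¹ •
      (κ (T.c i • T.z i) - κ (-(T.c i • T.z i)))
  E_F_ne : ∀ i j, i ≠ j → e i * f j - f j * e i = 0
  serre_E : ∀ i j, i ≠ j → qSerre (q.val ^ T.c i) (1 - T.cartan i j).toNat (e i) (e j) = 0
  serre_F : ∀ i j, i ≠ j → qSerre (q.val ^ T.c i) (1 - T.cartan i j).toNat (f i) (f j) = 0

/-- The same relations, imposed on the free algebra on the generators. -/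
inductive UqRel (T : RootDatum I Y X) (q : QParam k) :
    FreeAlgebra k (UqGen T) → FreeAlgebra k (UqGen T) → Prop
  | K_zero : UqRel T q (FreeAlgebra.ι k (.K 0)) 1
  | K_mul (μ ν : T.Z) : UqRel T q (FreeAlgebra.ι k (.K μ) * FreeAlgebra.ι k (.K ν))
      (FreeAlgebra.ι k (.K (μ + ν)))
  | K_E (μ : T.Z) (i : I) : UqRel T q (FreeAlgebra.ι k (.K μ) * FreeAlgebra.ι k (.E i))
      (((q.val ^ T.wt μ i : kˣ) : k) • (FreeAlgebra.ι k (.E i) * FreeAlgebra.ι k (.K μ)))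
  | K_F (μ : T.Z) (i : I) : UqRel T q (FreeAlgebra.ι k (.K μ) * FreeAlgebra.ι k (.F i))
      (((q.val ^ (-T.wt μ i) : kˣ) : k) • (FreeAlgebra.ι k (.F i) * FreeAlgebra.ι k (.K μ)))
  | E_F_self (i : I) : UqRel T q
      (FreeAlgebra.ι k (.E i) * FreeAlgebra.ι k (.F i) -
        FreeAlgebra.ι k (.F i) * FreeAlgebra.ι k (.E i))
      ((((q.val ^ T.c i : kˣ) : k) - ((q.val ^ T.c i)⁻¹ : kˣ))⁻¹ •
        (FreeAlgebra.ι k (.K (T.c i • T.z i)) - FreeAlgebra.ι k (.K (-(T.c i • T.z i)))))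
  | E_F_ne (i j : I) : i ≠ j → UqRel T q
      (FreeAlgebra.ι k (.E i) * FreeAlgebra.ι k (.F j) -
        FreeAlgebra.ι k (.F j) * FreeAlgebra.ι k (.E i)) 0
  | serre_E (i j : I) : i ≠ j → UqRel T q
      (qSerre (q.val ^ T.c i) (1 - T.cartan i j).toNat
        (FreeAlgebra.ι k (.E i)) (FreeAlgebra.ι k (.E j))) 0
  | serre_F (i j : I) : i ≠ j → UqRel T q
      (qSerre (q.val ^ T.c i) (1 - T.cartan i j).toNat
        (FreeAlgebra.ι k (.F i)) (FreeAlgebra.ι k (.F j))) 0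

/-- The quantized enveloping algebra `U_q(𝔗)`. -/
def Uq (T : RootDatum I Y X) (q : QParam k) : Type _ := RingQuot (UqRel T q)

namespace Uq
variable (T : RootDatum I Y X) (q : QParam k)

noncomputable instance : Ring (Uq T q) := inferInstanceAs (Ring (RingQuot (UqRel T q)))
noncomputable instance : Algebra k (Uq T q) := inferInstanceAs (Algebra k (RingQuot (UqRel T q)))

/-- The quotient map from the free algebra. -/
noncomputable def mk : FreeAlgebra k (UqGen T) →ₐ[k] Uq T q := RingQuot.mkAlgHom k (UqRel T q)

theorem mk_rel {a b : FreeAlgebra k (UqGen T)} (h : UqRel T q a b) : mk T q a = mk T q b :=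
  RingQuot.mkAlgHom_rel k h

noncomputable def E (i : I) : Uq T q := mk T q (FreeAlgebra.ι k (.E i))
noncomputable def F (i : I) : Uq T q := mk T q (FreeAlgebra.ι k (.F i))
noncomputable def K (μ : T.Z) : Uq T q := mk T q (FreeAlgebra.ι k (.K μ))

theorem relations : UqRelations T q (E T q) (F T q) (K T q) where
  K_zero := by simpa [K] using mk_rel T q .K_zero
  K_mul μ ν := by simpa [K] using mk_rel T q (.K_mul μ ν)
  K_E μ i := by simpa [E, K] using mk_rel T q (.K_E μ i)
  K_F μ i := by simpa [F, K] using mk_rel T q (.K_F μ i)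
  E_F_self i := by simpa [E, F, K] using mk_rel T q (.E_F_self i)
  E_F_ne i j h := by simpa [E, F] using mk_rel T q (.E_F_ne i j h)
  serre_E i j h := by simpa [qSerre_map, E, F] using mk_rel T q (.serre_E i j h)
  serre_F i j h := by simpa [qSerre_map, E, F] using mk_rel T q (.serre_F i j h)

variable {T q}

/-- The universal property of `U_q(𝔗)`. -/
noncomputable def lift {A : Type*} [Ring A] [Algebra k A] {e f : I → A} {κ : T.Z → A}
    (h : UqRelations T q e f κ) : Uq T q →ₐ[k] A :=
  RingQuot.liftAlgHom k ⟨FreeAlgebra.lift k fun g => match g with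
    | .E i => e i
    | .F i => f i
    | .K μ => κ μ, by
      intro a b hab
      induction hab with
      | K_zero => simpa using h.K_zero
      | K_mul μ ν => simpa using h.K_mul μ ν
      | K_E μ i => simpa using h.K_E μ i
      | K_F μ i => simpa using h.K_F μ i
      | E_F_self i => simpa using h.E_F_self i
      | E_F_ne i j hij => simpa using h.E_F_ne i j hij
      | serre_E i j hij => simpa [qSerre_map] using h.serre_E i j hij
      | serre_F i j hij => simpa [qSerre_map] using h.serre_F i j hij⟩

section lift
variable {A : Type*} [Ring A] [Algebra k A] {e f : I → A} {κ : T.Z → A}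
    (h : UqRelations T q e f κ)

@[simp] theorem lift_E (i : I) : lift h (E T q i) = e i := by
  simp only [lift, E, mk]
  erw [RingQuot.liftAlgHom_mkAlgHom_apply]
  simp

@[simp] theorem lift_F (i : I) : lift h (F T q i) = f i := by
  simp only [lift, F, mk]
  erw [RingQuot.liftAlgHom_mkAlgHom_apply]
  simp

@[simp] theorem lift_K (μ : T.Z) : lift h (K T q μ) = κ μ := by
  simp only [lift, K, mk]
  erw [RingQuot.liftAlgHom_mkAlgHom_apply]
  simp

end lift

theorem hom_ext {A : Type*} [Semiring A] [Algebra k A] {φ ψ : Uq T q →ₐ[k] A}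
    (hE : ∀ i, φ (E T q i) = ψ (E T q i)) (hF : ∀ i, φ (F T q i) = ψ (F T q i))
    (hK : ∀ μ, φ (K T q μ) = ψ (K T q μ)) : φ = ψ := by
  apply RingQuot.ringQuot_ext'
  apply FreeAlgebra.hom_ext
  funext g
  cases g with
  | E i => exact hE i
  | F i => exact hF i
  | K μ => exact hK μ

theorem induction {P : Uq T q → Prop} (hE : ∀ i, P (E T q i)) (hF : ∀ i, P (F T q i))
    (hK : ∀ μ, P (K T q μ)) (halg : ∀ r : k, P (algebraMap k _ r))
    (hadd : ∀ a b, P a → P b → P (a + b)) (hmul : ∀ a b, P a → P b → P (a * b))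
    (u : Uq T q) : P u := by
  obtain ⟨a, rfl⟩ := RingQuot.mkAlgHom_surjective k (UqRel T q) u
  induction a with
  | grade0 r =>
    have := halg r
    rwa [← (mk T q).commutes r] at this
  | grade1 g =>
    cases g with
    | E i => exact hE i
    | F i => exact hF i
    | K μ => exact hK μ
  | mul a b ha hb => rw [map_mul]; exact hmul _ _ ha hb
  | add a b ha hb => rw [map_add]; exact hadd _ _ ha hb

end Uq

namespace UqRelations
variable {T : RootDatum I Y X} {q : QParam k} {A : Type*} [Ring A] [Algebra k A]
  {e f : I → A} {κ : T.Z → A}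

theorem K_comm (h : UqRelations T q e f κ) (μ ν : T.Z) : κ μ * κ ν = κ ν * κ μ := by
  rw [h.K_mul, h.K_mul, add_comm]

theorem K_mul_neg (h : UqRelations T q e f κ) (μ : T.Z) : κ μ * κ (-μ) = 1 := by
  rw [h.K_mul, add_neg_cancel, h.K_zero]

theorem K_neg_mul (h : UqRelations T q e f κ) (μ : T.Z) : κ (-μ) * κ μ = 1 := by
  rw [h.K_mul, neg_add_cancel, h.K_zero]

theorem E_K (h : UqRelations T q e f κ) (μ : T.Z) (i : I) :
    e i * κ μ = ((q.val ^ (-T.wt μ i) : kˣ) : k) • (κ μ * e i) := by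
  rw [h.K_E, smul_smul, ← Units.val_mul, ← zpow_add]; simp

theorem F_K (h : UqRelations T q e f κ) (μ : T.Z) (i : I) :
    f i * κ μ = ((q.val ^ (T.wt μ i) : kˣ) : k) • (κ μ * f i) := by
  rw [h.K_F, smul_smul, ← Units.val_mul, ← zpow_add]; simp

end UqRelations

section tmul
variable {A B : Type*} [Ring A] [Algebra k A] [Ring B] [Algebra k B]

theorem qSerre_tmul_left (v : kˣ) (n : ℕ) {a b : A} (hab : a * b = b * a) (x z : B) :
    qSerre v n (a ⊗ₜ[k] x) (b ⊗ₜ[k] z) = (a ^ n * b) ⊗ₜ[k] qSerre v n x z := by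
  unfold qSerre
  rw [TensorProduct.tmul_sum]
  refine Finset.sum_congr rfl fun m hm => ?_
  have hm' : n = (n - m) + m := by have := Finset.mem_range.1 hm; omega
  have h1 : a ^ (n - m) * b * a ^ m = a ^ n * b := by
    have : b * a ^ m = a ^ m * b := (Commute.pow_left hab m).eq.symm
    rw [mul_assoc, this, ← mul_assoc, ← pow_add, ← hm']
  simp only [Algebra.TensorProduct.tmul_pow, Algebra.TensorProduct.tmul_mul_tmul, h1,
    TensorProduct.tmul_smul]

theorem qSerre_tmul_right (v : kˣ) (n : ℕ) {a b : B} (hab : a * b = b * a) (x z : A) :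
    qSerre v n (x ⊗ₜ[k] a) (z ⊗ₜ[k] b) = qSerre v n x z ⊗ₜ[k] (a ^ n * b) := by
  unfold qSerre
  rw [TensorProduct.sum_tmul]
  refine Finset.sum_congr rfl fun m hm => ?_
  have hm' : n = (n - m) + m := by have := Finset.mem_range.1 hm; omega
  have h1 : a ^ (n - m) * b * a ^ m = a ^ n * b := by
    have : b * a ^ m = a ^ m * b := (Commute.pow_left hab m).eq.symm
    rw [mul_assoc, this, ← mul_assoc, ← pow_add, ← hm']
  simp only [Algebra.TensorProduct.tmul_pow, Algebra.TensorProduct.tmul_mul_tmul, h1,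
    TensorProduct.smul_tmul']

end tmul

namespace Uq
variable (T : RootDatum I Y X) (q : QParam k)

/-- `H_i = K_i ^ c_i`, that is `K_{c_i i₁(i)}`. -/
noncomputable def H (i : I) : Uq T q := K T q (T.c i • T.z i)

/-- `H_i⁻¹`. -/
noncomputable def Hinv (i : I) : Uq T q := K T q (-(T.c i • T.z i))

theorem H_mul_Hinv (i : I) : H T q i * Hinv T q i = 1 := (relations T q).K_mul_neg _
theorem Hinv_mul_H (i : I) : Hinv T q i * H T q i = 1 := (relations T q).K_neg_mul _
theorem H_comm (i j : I) : H T q i * H T q j = H T q j * H T q i := (relations T q).K_comm _ _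
theorem Hinv_comm (i j : I) : Hinv T q i * Hinv T q j = Hinv T q j * Hinv T q i :=
  (relations T q).K_comm _ _
theorem H_Hinv_comm (i j : I) : H T q i * Hinv T q j = Hinv T q j * H T q i :=
  (relations T q).K_comm _ _

theorem H_E (i j : I) :
    H T q i * E T q j = ((q.val ^ T.dot i j : kˣ) : k) • (E T q j * H T q i) := by
  rw [H, (relations T q).K_E, T.wt_cz]

theorem Hinv_E (i j : I) :
    Hinv T q i * E T q j = ((q.val ^ (-T.dot i j) : kˣ) : k) • (E T q j * Hinv T q i) := by
  rw [Hinv, (relations T q).K_E, T.wt_neg, T.wt_cz]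

theorem H_F (i j : I) :
    H T q i * F T q j = ((q.val ^ (-T.dot i j) : kˣ) : k) • (F T q j * H T q i) := by
  rw [H, (relations T q).K_F, T.wt_cz]

theorem Hinv_F (i j : I) :
    Hinv T q i * F T q j = ((q.val ^ T.dot i j : kˣ) : k) • (F T q j * Hinv T q i) := by
  rw [Hinv, (relations T q).K_F, T.wt_neg, T.wt_cz, neg_neg]

theorem commutator (i j : I) [Decidable (i = j)] : E T q i * F T q j - F T q j * E T q i =
    (if i = j then (((q.val ^ T.c i : kˣ) : k) - ((q.val ^ T.c i)⁻¹ : kˣ))⁻¹ else 0) •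
      (H T q i - Hinv T q i) := by
  split_ifs with h
  · subst h; exact (relations T q).E_F_self i
  · rw [zero_smul]; exact (relations T q).E_F_ne i j h

theorem pow_cartan (i j : I) : (q.val ^ T.c i) ^ T.cartan i j = q.val ^ T.dot i j := by
  rw [← zpow_natCast, ← zpow_mul, T.c_mul_cartan]

theorem pow_two' (i : I) : (q.val ^ T.c i) ^ (2 : ℤ) = q.val ^ T.dot i i := by
  rw [← zpow_natCast, ← zpow_mul, T.dot_self, mul_comm]

theorem pow_neg_cartan (i j : I) : (q.val ^ T.c i) ^ (-T.cartan i j) = q.val ^ (-T.dot i j) := by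
  rw [zpow_neg, pow_cartan, zpow_neg]

theorem pow_neg_two (i : I) : (q.val ^ T.c i) ^ (-2 : ℤ) = q.val ^ (-T.dot i i) := by
  rw [zpow_neg, pow_two', zpow_neg]

theorem notRoot (i : I) : NotRootOfUnity (q.val ^ T.c i) := q.not_root.pow (T.c_ne_zero i)

theorem toNat_cartan {i j : I} (h : i ≠ j) :
    (((1 - T.cartan i j).toNat : ℕ) : ℤ) = 1 - T.cartan i j := by
  have := T.cartan_nonpos h
  omega

theorem comul_relations : UqRelations T q (A := Uq T q ⊗[k] Uq T q)
    (fun i => E T q i ⊗ₜ 1 + H T q i ⊗ₜ E T q i)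
    (fun i => F T q i ⊗ₜ Hinv T q i + 1 ⊗ₜ F T q i)
    (fun μ => K T q μ ⊗ₜ K T q μ) where
  K_zero := by rw [(relations T q).K_zero]; rfl
  K_mul μ ν := by rw [Algebra.TensorProduct.tmul_mul_tmul, (relations T q).K_mul]
  K_E μ i := by
    have h1 : K T q μ * H T q i = H T q i * K T q μ := (relations T q).K_comm _ _
    simp only [mul_add, add_mul, Algebra.TensorProduct.tmul_mul_tmul, (relations T q).K_E, mul_one,
      one_mul, h1, TensorProduct.tmul_smul, TensorProduct.smul_tmul', smul_add]
  K_F μ i := by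
    have h1 : K T q μ * Hinv T q i = Hinv T q i * K T q μ := (relations T q).K_comm _ _
    simp only [mul_add, add_mul, Algebra.TensorProduct.tmul_mul_tmul, (relations T q).K_F, mul_one,
      one_mul, h1, TensorProduct.tmul_smul, TensorProduct.smul_tmul', smul_add]
  E_F_self i := by
    have hc := (relations T q).E_F_self i
    change E T q i * F T q i - F T q i * E T q i = _ • (H T q i - Hinv T q i) at hc
    have e1 : E T q i * F T q i = _ := eq_add_of_sub_eq hc
    change _ = _ • (H T q i ⊗ₜ H T q i - Hinv T q i ⊗ₜ Hinv T q i)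
    generalize (((q.val ^ T.c i : kˣ) : k) - ((q.val ^ T.c i)⁻¹ : kˣ))⁻¹ = r at *
    have h2 : (H T q i * F T q i) ⊗ₜ[k] (E T q i * Hinv T q i) =
        (F T q i * H T q i) ⊗ₜ[k] (Hinv T q i * E T q i) := by
      rw [H_F, Hinv_E, TensorProduct.tmul_smul, TensorProduct.smul_tmul']
    simp only [mul_add, add_mul, Algebra.TensorProduct.tmul_mul_tmul, mul_one, one_mul, e1, h2]
    simp only [TensorProduct.add_tmul, TensorProduct.tmul_add, smul_sub, TensorProduct.sub_tmul,
      TensorProduct.tmul_sub, TensorProduct.tmul_smul, ← TensorProduct.smul_tmul']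
    abel
  E_F_ne i j hij := by
    have e1 : E T q i * F T q j = F T q j * E T q i :=
      sub_eq_zero.1 ((relations T q).E_F_ne i j hij)
    have h2 : (H T q i * F T q j) ⊗ₜ[k] (E T q i * Hinv T q j) =
        (F T q j * H T q i) ⊗ₜ[k] (Hinv T q j * E T q i) := by
      rw [H_F, Hinv_E, T.dot_comm j i, TensorProduct.tmul_smul, TensorProduct.smul_tmul']
    simp only [mul_add, add_mul, Algebra.TensorProduct.tmul_mul_tmul, mul_one, one_mul, e1, h2]
    abel
  serre_E i j hij := by
    rw [add_comm, add_comm (E T q j ⊗ₜ 1), qSerre_add (notRoot T q i) (toNat_cartan T hij),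
      qSerre_tmul_left _ _ (H_comm T q i j), qSerre_tmul_right _ _ rfl,
      (relations T q).serre_E i j hij]
    · simp
    · simp only [Algebra.TensorProduct.tmul_mul_tmul, mul_one, one_mul, H_E, pow_two',
        TensorProduct.smul_tmul']
    · simp only [Algebra.TensorProduct.tmul_mul_tmul, mul_one, one_mul, H_E, pow_cartan,
        TensorProduct.smul_tmul', T.dot_comm j i]
    · simp only [Algebra.TensorProduct.tmul_mul_tmul, mul_one, one_mul, H_E, pow_cartan,
        TensorProduct.smul_tmul']
  serre_F i j hij := by
    rw [qSerre_add (notRoot T q i) (toNat_cartan T hij),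
      qSerre_tmul_left _ _ rfl, qSerre_tmul_right _ _ (Hinv_comm T q i j),
      (relations T q).serre_F i j hij]
    · simp
    · simp only [Algebra.TensorProduct.tmul_mul_tmul, mul_one, one_mul, Hinv_F, pow_two',
        TensorProduct.tmul_smul]
    · simp only [Algebra.TensorProduct.tmul_mul_tmul, mul_one, one_mul, Hinv_F, pow_cartan,
        TensorProduct.tmul_smul, T.dot_comm j i]
    · simp only [Algebra.TensorProduct.tmul_mul_tmul, mul_one, one_mul, Hinv_F, pow_cartan,
        TensorProduct.tmul_smul]

theorem counit_relations : UqRelations T q (A := k) (fun _ => 0) (fun _ => 0) (fun _ => 1) where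
  K_zero := rfl
  K_mul _ _ := one_mul _
  K_E _ _ := by simp
  K_F _ _ := by simp
  E_F_self _ := by simp
  E_F_ne _ _ _ := by simp
  serre_E _ _ _ := qSerre_zero _ _ _
  serre_F _ _ _ := qSerre_zero _ _ _

open MulOpposite in
theorem antipode_relations : UqRelations T q (A := (Uq T q)ᵐᵒᵖ)
    (fun i => op (-(Hinv T q i * E T q i)))
    (fun i => op (-(F T q i * H T q i)))
    (fun μ => op (K T q (-μ))) where
  K_zero := by rw [neg_zero, (relations T q).K_zero]; rfl
  K_mul μ ν := by rw [← op_mul, (relations T q).K_mul, neg_add, add_comm]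
  K_E μ i := by
    have h1 : Hinv T q i * K T q (-μ) = K T q (-μ) * Hinv T q i := (relations T q).K_comm _ _
    simp only [← op_mul, ← op_smul, neg_mul, mul_neg]
    rw [mul_assoc, (relations T q).E_K, T.wt_neg, neg_neg, mul_smul_comm, ← mul_assoc, h1]
    simp [mul_assoc]
  K_F μ i := by
    have h1 : H T q i * K T q (-μ) = K T q (-μ) * H T q i := (relations T q).K_comm _ _
    simp only [← op_mul, ← op_smul, neg_mul, mul_neg]
    rw [mul_assoc, h1, ← mul_assoc, (relations T q).F_K, T.wt_neg, smul_mul_assoc]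
    simp [mul_assoc]
  E_F_self i := by
    have hc := (relations T q).E_F_self i
    change E T q i * F T q i - F T q i * E T q i = _ • (H T q i - Hinv T q i) at hc
    simp only [← op_mul, ← op_smul, ← op_sub, neg_mul_neg, neg_neg]
    congr 1
    change _ = _ • (Hinv T q i - H T q i)
    have a1 : F T q i * H T q i * (Hinv T q i * E T q i) = F T q i * E T q i := by
      rw [mul_assoc, ← mul_assoc (H T q i), H_mul_Hinv, one_mul]
    have a2 : Hinv T q i * E T q i * (F T q i * H T q i) = E T q i * F T q i := by
      rw [mul_assoc, ← mul_assoc (E T q i), ← mul_assoc, ← mul_assoc, Hinv_E, smul_mul_assoc,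
        mul_assoc (E T q i), Hinv_F, mul_smul_comm, smul_smul, ← Units.val_mul, ← zpow_add,
        neg_add_cancel, zpow_zero, Units.val_one, one_smul, mul_assoc, mul_assoc, Hinv_mul_H,
        mul_one]
    rw [a1, a2, ← neg_sub, hc, ← smul_neg, neg_sub]
  E_F_ne i j hij := by
    have e1 : E T q i * F T q j = F T q j * E T q i :=
      sub_eq_zero.1 ((relations T q).E_F_ne i j hij)
    simp only [← op_mul, ← op_sub, neg_mul_neg]
    rw [sub_eq_zero.2, op_zero]
    have a1 : F T q j * H T q j * (Hinv T q i * E T q i) =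
        ((q.val ^ (T.dot j i - T.dot i i) : kˣ) : k) •
          (F T q j * E T q i * (H T q j * Hinv T q i)) := by
      rw [Hinv_E, mul_smul_comm, mul_assoc, ← mul_assoc (H T q j), H_E, smul_mul_assoc,
        mul_smul_comm, smul_smul, ← Units.val_mul, ← zpow_add, neg_add_eq_sub]
      simp only [mul_assoc]
    have a2 : Hinv T q i * E T q i * (F T q j * H T q j) =
        ((q.val ^ (T.dot j i - T.dot i i) : kˣ) : k) •
          (E T q i * F T q j * (H T q j * Hinv T q i)) := by
      rw [Hinv_E, smul_mul_assoc, mul_assoc, ← mul_assoc (Hinv T q i), Hinv_F, smul_mul_assoc,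
        mul_smul_comm, smul_smul, ← Units.val_mul, ← zpow_add, neg_add_eq_sub, T.dot_comm i j,
        H_Hinv_comm]
      simp only [mul_assoc]
    rw [a1, a2, e1]
  serre_E i j hij := by
    have hE : ∀ i, op (-(Hinv T q i * E T q i)) =
        (-((q.val ^ (-T.dot i i) : kˣ) : k)) • (op (Hinv T q i) * op (E T q i)) := by
      intro i
      rw [Hinv_E, ← op_mul, ← op_smul, neg_smul]
    rw [hE, hE, qSerre_smul]
    obtain ⟨c, hc⟩ := qSerre_twist (notRoot T q i) (toNat_cartan T hij)
      (x := op (E T q i)) (z := op (E T q j)) (a := op (Hinv T q i)) (b := op (Hinv T q j))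
      (by rw [← op_mul, ← op_mul, Hinv_comm])
      (by rw [← op_mul, ← op_mul, Hinv_E, pow_neg_two, op_smul])
      (by rw [← op_mul, ← op_mul, Hinv_E, pow_neg_cartan, op_smul])
      (by rw [← op_mul, ← op_mul, Hinv_E, pow_neg_cartan, op_smul, T.dot_comm])
    rw [hc, qSerre_op, (relations T q).serre_E i j hij]
    simp
  serre_F i j hij := by
    have hF : ∀ i, op (-(F T q i * H T q i)) =
        (-1 : k) • (op (H T q i) * op (F T q i)) := by
      intro i
      rw [← op_mul, ← op_smul, neg_smul, one_smul]
    rw [hF, hF, qSerre_smul]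
    obtain ⟨c, hc⟩ := qSerre_twist (notRoot T q i) (toNat_cartan T hij)
      (x := op (F T q i)) (z := op (F T q j)) (a := op (H T q i)) (b := op (H T q j))
      (by rw [← op_mul, ← op_mul, H_comm])
      (by rw [← op_mul, ← op_mul, H_F, pow_neg_two, op_smul])
      (by rw [← op_mul, ← op_mul, H_F, pow_neg_cartan, op_smul])
      (by rw [← op_mul, ← op_mul, H_F, pow_neg_cartan, op_smul, T.dot_comm])
    rw [hc, qSerre_op, (relations T q).serre_F i j hij]
    simp

/-- The coproduct: `ΔE_i = E_i ⊗ 1 + H_i ⊗ E_i`, `ΔF_i = F_i ⊗ H_i⁻¹ + 1 ⊗ F_i`,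
`ΔK_μ = K_μ ⊗ K_μ`. -/
noncomputable def comulHom : Uq T q →ₐ[k] Uq T q ⊗[k] Uq T q := lift (comul_relations T q)

/-- The counit: `ε(E_i) = ε(F_i) = 0`, `ε(K_μ) = 1`. -/
noncomputable def counitHom : Uq T q →ₐ[k] k := lift (counit_relations T q)

/-- The antipode `SE_i = -H_i⁻¹E_i`, `SF_i = -F_iH_i`, `SK_μ = K_{-μ}`, as a homomorphism to the
opposite algebra. -/
noncomputable def antipodeHom : Uq T q →ₐ[k] (Uq T q)ᵐᵒᵖ := lift (antipode_relations T q)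

noncomputable instance : Bialgebra k (Uq T q) :=
  Bialgebra.ofAlgHom (comulHom T q) (counitHom T q)
    (hom_ext
      (fun i => by
        simp [comulHom, H, TensorProduct.add_tmul, TensorProduct.tmul_add,
          Algebra.TensorProduct.one_def, add_assoc])
      (fun i => by
        simp [comulHom, Hinv, TensorProduct.add_tmul, TensorProduct.tmul_add,
          Algebra.TensorProduct.one_def, add_assoc])
      (fun μ => by simp [comulHom]))
    (hom_ext (fun i => by simp [comulHom, counitHom, H]) (fun i => by simp [comulHom, counitHom])
      (fun μ => by simp [comulHom, counitHom]))
    (hom_ext (fun i => by simp [comulHom, counitHom]) (fun i => by simp [comulHom, counitHom, Hinv])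
      (fun μ => by simp [comulHom, counitHom]))

theorem comul_eq (u : Uq T q) : Coalgebra.comul (R := k) u = comulHom T q u := rfl
theorem counit_eq (u : Uq T q) : Coalgebra.counit (R := k) u = counitHom T q u := rfl

/-- The antipode as a linear endomorphism. -/
noncomputable def antipodeLin : Uq T q →ₗ[k] Uq T q :=
  (MulOpposite.opLinearEquiv k).symm.toLinearMap ∘ₗ (antipodeHom T q).toLinearMap

theorem antipodeLin_mul (u w : Uq T q) :
    antipodeLin T q (u * w) = antipodeLin T q w * antipodeLin T q u := by
  simp [antipodeLin]

theorem antipodeLin_algebraMap (r : k) : antipodeLin T q (algebraMap k _ r) = algebraMap k _ r := by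
  simp [antipodeLin]

@[simp] theorem antipodeLin_E (i : I) :
    antipodeLin T q (E T q i) = -(Hinv T q i * E T q i) := by simp [antipodeLin, antipodeHom]
@[simp] theorem antipodeLin_F (i : I) :
    antipodeLin T q (F T q i) = -(F T q i * H T q i) := by simp [antipodeLin, antipodeHom]
@[simp] theorem antipodeLin_K (μ : T.Z) :
    antipodeLin T q (K T q μ) = K T q (-μ) := by simp [antipodeLin, antipodeHom]
@[simp] theorem antipodeLin_one : antipodeLin T q 1 = 1 := by simp [antipodeLin]

theorem antipode_left (u : Uq T q) :
    LinearMap.mul' k _ ((antipodeLin T q).rTensor _ (comulHom T q u)) =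
      algebraMap k _ (counitHom T q u) := by
  have key : ∀ (t s : Uq T q ⊗[k] Uq T q) (c : k),
      LinearMap.mul' k _ ((antipodeLin T q).rTensor _ t) = algebraMap k _ c →
      LinearMap.mul' k _ ((antipodeLin T q).rTensor _ (t * s)) =
        c • LinearMap.mul' k _ ((antipodeLin T q).rTensor _ s) := by
    intro t s c ht
    induction s with
    | zero => simp
    | add s₁ s₂ h₁ h₂ => simp only [mul_add, map_add, h₁, h₂, smul_add]
    | tmul a b =>
      have : ∀ t : Uq T q ⊗[k] Uq T q,
          LinearMap.mul' k _ ((antipodeLin T q).rTensor _ (t * a ⊗ₜ b)) =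
          antipodeLin T q a * LinearMap.mul' k _ ((antipodeLin T q).rTensor _ t) * b := by
        intro t
        induction t with
        | zero => simp
        | add s₁ s₂ h₁ h₂ => simp only [add_mul, mul_add, map_add, h₁, h₂]
        | tmul x y => simp [antipodeLin_mul, mul_assoc]
      rw [this, ht, ← Algebra.commutes, mul_assoc, ← Algebra.smul_def]
      simp
  induction u using Uq.induction with
  | hE i => simp [comulHom, counitHom, H, Hinv]
  | hF i => simp [comulHom, counitHom, mul_assoc, H_mul_Hinv]
  | hK μ => simp [comulHom, counitHom, (relations T q).K_neg_mul]
  | halg r => simp [Algebra.TensorProduct.algebraMap_apply, antipodeLin_algebraMap]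
  | hadd a b ha hb => simp only [map_add, ha, hb]
  | hmul a b ha hb => rw [map_mul, key _ _ _ ha, hb, map_mul, map_mul, Algebra.smul_def]

theorem antipode_right (u : Uq T q) :
    LinearMap.mul' k _ ((antipodeLin T q).lTensor _ (comulHom T q u)) =
      algebraMap k _ (counitHom T q u) := by
  have key : ∀ (t s : Uq T q ⊗[k] Uq T q) (c : k),
      LinearMap.mul' k _ ((antipodeLin T q).lTensor _ s) = algebraMap k _ c →
      LinearMap.mul' k _ ((antipodeLin T q).lTensor _ (t * s)) =
        c • LinearMap.mul' k _ ((antipodeLin T q).lTensor _ t) := by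
    intro t s c hs
    induction t with
    | zero => simp
    | add s₁ s₂ h₁ h₂ => simp only [add_mul, map_add, h₁, h₂, smul_add]
    | tmul a b =>
      have : ∀ s : Uq T q ⊗[k] Uq T q,
          LinearMap.mul' k _ ((antipodeLin T q).lTensor _ (a ⊗ₜ b * s)) =
          a * LinearMap.mul' k _ ((antipodeLin T q).lTensor _ s) * antipodeLin T q b := by
        intro s
        induction s with
        | zero => simp
        | add s₁ s₂ h₁ h₂ => simp only [add_mul, mul_add, map_add, h₁, h₂]
        | tmul x y => simp [antipodeLin_mul, mul_assoc]
      rw [this, hs, ← Algebra.commutes, mul_assoc, ← Algebra.smul_def]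
      simp
  induction u using Uq.induction with
  | hE i => simp [comulHom, counitHom, ← mul_assoc, H_mul_Hinv]
  | hF i => simp [comulHom, counitHom, H, Hinv]
  | hK μ => simp [comulHom, counitHom, (relations T q).K_mul_neg]
  | halg r => simp [Algebra.TensorProduct.algebraMap_apply, antipodeLin_one]
  | hadd a b ha hb => simp only [map_add, ha, hb]
  | hmul a b ha hb => rw [map_mul, key _ _ _ hb, ha, map_mul, map_mul, Algebra.smul_def,
      ← Algebra.commutes]

noncomputable instance : HopfAlgebra k (Uq T q) where
  antipode := antipodeLin T q
  mul_antipode_rTensor_comul := LinearMap.ext (antipode_left T q)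
  mul_antipode_lTensor_comul := LinearMap.ext (antipode_right T q)

theorem antipode_eq (u : Uq T q) : HopfAlgebra.antipode k u = antipodeLin T q u := rfl

end Uq

section SubHopf
variable {A : Type*} [Ring A] [HopfAlgebra k A] (S : Subalgebra k A)

/-- `S ⊗ S → A ⊗ A`. -/
noncomputable def subIncl₂ : S ⊗[k] S →ₐ[k] A ⊗[k] A := Algebra.TensorProduct.map S.val S.val

theorem subIncl₂_injective : Function.Injective (subIncl₂ S) :=
  TensorProduct.map_injective_of_flat_flat S.val.toLinearMap S.val.toLinearMap
    Subtype.val_injective Subtype.val_injective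

theorem subIncl₃_injective : Function.Injective
    (Algebra.TensorProduct.map S.val (subIncl₂ S) : S ⊗[k] (S ⊗[k] S) →ₐ[k] A ⊗[k] (A ⊗[k] A)) :=
  TensorProduct.map_injective_of_flat_flat S.val.toLinearMap (subIncl₂ S).toLinearMap
    Subtype.val_injective (subIncl₂_injective S)

/-- `S` is a sub-Hopf algebra of `A`. -/
structure IsSubHopf : Prop where
  comul_mem : ∀ x ∈ S, Coalgebra.comul (R := k) x ∈ (subIncl₂ S).range
  antipode_mem : ∀ x ∈ S, HopfAlgebra.antipode k x ∈ S

namespace IsSubHopf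
variable {S} (h : IsSubHopf S)

/-- The restricted coproduct. -/
noncomputable def comulHom : S →ₐ[k] S ⊗[k] S :=
  (AlgEquiv.ofInjective (subIncl₂ S) (subIncl₂_injective S)).symm.toAlgHom.comp
    (((Bialgebra.comulAlgHom k A).comp S.val).codRestrict _ fun x => h.comul_mem x x.2)

theorem incl_comulHom (x : S) : subIncl₂ S (h.comulHom x) = Coalgebra.comul (R := k) (x : A) := by
  have := AlgEquiv.apply_symm_apply (AlgEquiv.ofInjective (subIncl₂ S) (subIncl₂_injective S))
    ((((Bialgebra.comulAlgHom k A).comp S.val).codRestrict _ fun x => h.comul_mem x x.2) x)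
  exact congrArg Subtype.val this

/-- The bialgebra structure of a sub-Hopf algebra. -/
noncomputable abbrev bialgebra : Bialgebra k S :=
  Bialgebra.ofAlgHom h.comulHom ((Bialgebra.counitAlgHom k A).comp S.val)
    (by
      apply AlgHom.ext
      intro x
      apply subIncl₃_injective S
      have l1 : ∀ t : S ⊗[k] S, Algebra.TensorProduct.map S.val (subIncl₂ S)
          (Algebra.TensorProduct.assoc k k k S S S
            (Algebra.TensorProduct.map h.comulHom (AlgHom.id k S) t)) =
          Algebra.TensorProduct.assoc k k k A A A (Algebra.TensorProduct.map
            (Bialgebra.comulAlgHom k A) (AlgHom.id k A) (subIncl₂ S t)) := by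
        intro t
        induction t with
        | zero => simp
        | add a b ha hb => simp only [map_add, ha, hb]
        | tmul a b =>
          have l2 : ∀ s : S ⊗[k] S, Algebra.TensorProduct.map S.val (subIncl₂ S)
              (Algebra.TensorProduct.assoc k k k S S S (s ⊗ₜ b)) =
              Algebra.TensorProduct.assoc k k k A A A (subIncl₂ S s ⊗ₜ (b : A)) := by
            intro s
            induction s with
            | zero => simp
            | add a b ha hb => simp only [map_add, TensorProduct.add_tmul, ha, hb]
            | tmul a b => simp [subIncl₂]
          rw [Algebra.TensorProduct.map_tmul, AlgHom.id_apply, l2, h.incl_comulHom]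
          simp [subIncl₂]
      have l3 : ∀ t : S ⊗[k] S, Algebra.TensorProduct.map S.val (subIncl₂ S)
            (Algebra.TensorProduct.map (AlgHom.id k S) h.comulHom t) =
          Algebra.TensorProduct.map (AlgHom.id k A)
            (Bialgebra.comulAlgHom k A) (subIncl₂ S t) := by
        intro t
        induction t with
        | zero => simp
        | add a b ha hb => simp only [map_add, ha, hb]
        | tmul a b =>
          rw [Algebra.TensorProduct.map_tmul, Algebra.TensorProduct.map_tmul, h.incl_comulHom]
          simp [subIncl₂]
      have := Coalgebra.coassoc_apply (R := k) (x : A)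
      refine (l1 (h.comulHom x)).trans (Eq.trans ?_ (l3 (h.comulHom x)).symm)
      rw [h.incl_comulHom]
      exact this)
    (by
      apply AlgHom.ext
      intro x
      apply (Algebra.TensorProduct.lid k S).injective
      apply Subtype.val_injective
      have l1 : ∀ t : S ⊗[k] S, (Algebra.TensorProduct.lid k S (Algebra.TensorProduct.map
          ((Bialgebra.counitAlgHom k A).comp S.val) (AlgHom.id k S) t) : A) =
          Algebra.TensorProduct.lid k A (Algebra.TensorProduct.map
            (Bialgebra.counitAlgHom k A) (AlgHom.id k A) (subIncl₂ S t)) := by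
        intro t
        induction t with
        | zero => simp
        | add a b ha hb => simp only [map_add, Subalgebra.coe_add, ha, hb]
        | tmul a b => simp [subIncl₂]
      have := Coalgebra.rTensor_counit_comul (R := k) (x : A)
      calc _ = _ := l1 (h.comulHom x)
        _ = Algebra.TensorProduct.lid k A (1 ⊗ₜ (x : A)) := by
          rw [h.incl_comulHom]; exact congrArg _ this
        _ = _ := by simp)
    (by
      apply AlgHom.ext
      intro x
      apply (Algebra.TensorProduct.rid k k S).injective
      apply Subtype.val_injective
      have l1 : ∀ t : S ⊗[k] S, (Algebra.TensorProduct.rid k k S (Algebra.TensorProduct.map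
          (AlgHom.id k S) ((Bialgebra.counitAlgHom k A).comp S.val) t) : A) =
          Algebra.TensorProduct.rid k k A (Algebra.TensorProduct.map
            (AlgHom.id k A) (Bialgebra.counitAlgHom k A) (subIncl₂ S t)) := by
        intro t
        induction t with
        | zero => simp
        | add a b ha hb => simp only [map_add, Subalgebra.coe_add, ha, hb]
        | tmul a b => simp [subIncl₂]
      have := Coalgebra.lTensor_counit_comul (R := k) (x : A)
      calc _ = _ := l1 (h.comulHom x)
        _ = Algebra.TensorProduct.rid k k A ((x : A) ⊗ₜ 1) := by
          rw [h.incl_comulHom]; exact congrArg _ this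
        _ = _ := by simp)

/-- The Hopf algebra structure of a sub-Hopf algebra. -/
noncomputable abbrev hopfAlgebra : HopfAlgebra k S :=
  { h.bialgebra with
    antipode := ((HopfAlgebra.antipode k (A := A)).comp S.val.toLinearMap).codRestrict
      S.toSubmodule fun x => h.antipode_mem x x.2
    mul_antipode_rTensor_comul := by
      ext x
      have l1 : ∀ t : S ⊗[k] S, (LinearMap.mul' k S (((((HopfAlgebra.antipode k (A := A)).comp
          S.val.toLinearMap).codRestrict S.toSubmodule fun x => h.antipode_mem x x.2) :
            S →ₗ[k] S).rTensor S t) : A) =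
          LinearMap.mul' k A ((HopfAlgebra.antipode k).rTensor A (subIncl₂ S t)) := by
        intro t
        induction t with
        | zero => simp
        | add a b ha hb => simp only [map_add, Subalgebra.coe_add, ha, hb]
        | tmul a b => simp [subIncl₂]; rfl
      refine (l1 (h.comulHom x)).trans ?_
      rw [h.incl_comulHom, HopfAlgebra.mul_antipode_rTensor_comul_apply]
      rfl
    mul_antipode_lTensor_comul := by
      ext x
      have l1 : ∀ t : S ⊗[k] S, (LinearMap.mul' k S (((((HopfAlgebra.antipode k (A := A)).comp
          S.val.toLinearMap).codRestrict S.toSubmodule fun x => h.antipode_mem x x.2) :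
            S →ₗ[k] S).lTensor S t) : A) =
          LinearMap.mul' k A ((HopfAlgebra.antipode k).lTensor A (subIncl₂ S t)) := by
        intro t
        induction t with
        | zero => simp
        | add a b ha hb => simp only [map_add, Subalgebra.coe_add, ha, hb]
        | tmul a b => simp [subIncl₂]; rfl
      refine (l1 (h.comulHom x)).trans ?_
      rw [h.incl_comulHom, HopfAlgebra.mul_antipode_lTensor_comul_apply]
      rfl }

end IsSubHopf
end SubHopf

section NegBorel
variable (T : RootDatum I Y X) (q : QParam k)

/-- The negative Borel subalgebra, generated by all `F_i` and `K_μ`. -/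
noncomputable def negBorel : Subalgebra k (Uq T q) :=
  Algebra.adjoin k (Set.range (Uq.F T q) ∪ Set.range (Uq.K T q))

theorem F_mem_negBorel (i : I) : Uq.F T q i ∈ negBorel T q :=
  Algebra.subset_adjoin (Or.inl ⟨i, rfl⟩)

theorem K_mem_negBorel (μ : T.Z) : Uq.K T q μ ∈ negBorel T q :=
  Algebra.subset_adjoin (Or.inr ⟨μ, rfl⟩)

theorem negBorel_isSubHopf : IsSubHopf (negBorel T q) where
  comul_mem x hx := by
    have hle : negBorel T q ≤ (subIncl₂ (negBorel T q)).range.comap (Uq.comulHom T q) := by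
      apply Algebra.adjoin_le
      rintro _ (⟨i, rfl⟩ | ⟨μ, rfl⟩)
      · refine ⟨⟨_, F_mem_negBorel T q i⟩ ⊗ₜ
          ⟨Uq.Hinv T q i, K_mem_negBorel T q (-(T.c i • T.z i))⟩ +
          1 ⊗ₜ ⟨_, F_mem_negBorel T q i⟩, ?_⟩
        simp [subIncl₂, Uq.comulHom]
      · refine ⟨⟨_, K_mem_negBorel T q μ⟩ ⊗ₜ ⟨_, K_mem_negBorel T q μ⟩, ?_⟩
        simp [subIncl₂, Uq.comulHom]
    exact hle hx
  antipode_mem x hx := by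
    rw [Uq.antipode_eq]
    induction hx using Algebra.adjoin_induction with
    | mem x hx =>
      rcases hx with ⟨i, rfl⟩ | ⟨μ, rfl⟩
      · rw [Uq.antipodeLin_F]
        exact neg_mem (mul_mem (F_mem_negBorel T q i) (K_mem_negBorel T q _))
      · rw [Uq.antipodeLin_K]; exact K_mem_negBorel T q _
    | algebraMap r => rw [Uq.antipodeLin_algebraMap]; exact Subalgebra.algebraMap_mem _ r
    | add x y _ _ hx hy => rw [map_add]; exact add_mem hx hy
    | mul x y _ _ hx hy => rw [Uq.antipodeLin_mul]; exact mul_mem hy hx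

noncomputable instance : HopfAlgebra k (negBorel T q) := (negBorel_isSubHopf T q).hopfAlgebra

end NegBorel

section Grading
variable (T : RootDatum I Y X) (q : QParam k)

theorem qSerre_single {A : Type*} [Ring A] [Algebra k A] (v : kˣ) (n : ℕ) (a b : ℤ) (x z : A) :
    qSerre v n (AddMonoidAlgebra.single a x) (AddMonoidAlgebra.single b z) =
      AddMonoidAlgebra.single (n • a + b) (qSerre v n x z) := by
  unfold qSerre
  rw [← AddMonoidAlgebra.lsingle_apply (R := k) (n • a + b), map_sum]
  refine Finset.sum_congr rfl fun m hm => ?_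
  have hm' : n = (n - m) + m := by have := Finset.mem_range.1 hm; omega
  rw [map_smul, AddMonoidAlgebra.lsingle_apply, AddMonoidAlgebra.single_pow,
    AddMonoidAlgebra.single_pow, AddMonoidAlgebra.single_mul_single,
    AddMonoidAlgebra.single_mul_single]
  congr 2
  have : n • a = (n - m) • a + m • a := by rw [← add_smul, ← hm']
  rw [this]; abel

theorem coaction_relations (γ : I → ℤ) : UqRelations T q (A := AddMonoidAlgebra (Uq T q) ℤ)
    (fun i => .single (γ i) (Uq.E T q i))
    (fun i => .single (-γ i) (Uq.F T q i))
    (fun μ => .single 0 (Uq.K T q μ)) where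
  K_zero := by rw [(Uq.relations T q).K_zero]; rfl
  K_mul μ ν := by rw [AddMonoidAlgebra.single_mul_single, (Uq.relations T q).K_mul, add_zero]
  K_E μ i := by
    rw [AddMonoidAlgebra.single_mul_single, AddMonoidAlgebra.single_mul_single,
      (Uq.relations T q).K_E, AddMonoidAlgebra.smul_single, zero_add, add_zero]
  K_F μ i := by
    rw [AddMonoidAlgebra.single_mul_single, AddMonoidAlgebra.single_mul_single,
      (Uq.relations T q).K_F, AddMonoidAlgebra.smul_single, zero_add, add_zero]
  E_F_self i := by
    rw [AddMonoidAlgebra.single_mul_single, AddMonoidAlgebra.single_mul_single,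
      neg_add_cancel, add_neg_cancel, ← AddMonoidAlgebra.single_sub, (Uq.relations T q).E_F_self,
      ← AddMonoidAlgebra.single_sub, AddMonoidAlgebra.smul_single]
  E_F_ne i j hij := by
    rw [AddMonoidAlgebra.single_mul_single, AddMonoidAlgebra.single_mul_single,
      add_comm (-γ j), ← AddMonoidAlgebra.single_sub, (Uq.relations T q).E_F_ne i j hij,
      AddMonoidAlgebra.single_zero]
  serre_E i j hij := by
    rw [qSerre_single, (Uq.relations T q).serre_E i j hij, AddMonoidAlgebra.single_zero]
  serre_F i j hij := by
    rw [qSerre_single, (Uq.relations T q).serre_F i j hij, AddMonoidAlgebra.single_zero]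

/-- The `k[ℤ]`-coaction `u ↦ u tᵈ` (`u` of degree `d`) given by the `ℤ`-grading of `U_q(𝔗)`
with `deg E_i = γ i`, `deg F_i = -γ i`, `deg K_μ = 0`. -/
noncomputable def coaction (γ : I → ℤ) : Uq T q →ₐ[k] AddMonoidAlgebra (Uq T q) ℤ :=
  Uq.lift (coaction_relations T q γ)

/-- The homogeneous component of degree `n` of `U_q(𝔗)`, for the `ℤ`-grading with
`deg E_i = γ i`, `deg F_i = -γ i`, `deg K_μ = 0`. -/
noncomputable def Uq.degreePart (γ : I → ℤ) (n : ℤ) : Submodule k (Uq T q) :=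
  LinearMap.eqLocus (coaction T q γ).toLinearMap (AddMonoidAlgebra.lsingle (R := k) n)

theorem Uq.mem_degreePart {γ : I → ℤ} {n : ℤ} {u : Uq T q} :
    u ∈ Uq.degreePart T q γ n ↔ coaction T q γ u = AddMonoidAlgebra.single n u := Iff.rfl

open Classical in
/-- The function `χ_D : I → {0, 1}`. -/
noncomputable def chi (D : Set I) (i : I) : ℤ := if i ∈ D then 1 else 0

/-- The `ℕ`-grading of the negative Borel subalgebra with `deg F_i = χ_D(i)`, `deg K_μ = 0`: the
component of degree `n` consists of the elements of degree `-n` in `U_q(𝔗)`, where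
`deg E_i = χ_D(i) = -deg F_i`. -/
noncomputable def negBorelGrading (D : Set I) (n : ℕ) : Submodule k (negBorel T q) :=
  (Uq.degreePart T q (chi D) (-(n : ℤ))).comap (negBorel T q).val.toLinearMap

theorem mem_negBorelGrading {D : Set I} {n : ℕ} {x : negBorel T q} :
    x ∈ negBorelGrading T q D n ↔
      coaction T q (chi D) x = AddMonoidAlgebra.single (-(n : ℤ)) (x : Uq T q) := Iff.rfl

instance (D : Set I) : SetLike.GradedMonoid (negBorelGrading T q D) where
  one_mem := by rw [mem_negBorelGrading, OneMemClass.coe_one, map_one]; rfl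
  mul_mem m n x y hx hy := by
    rw [mem_negBorelGrading] at *
    rw [Subalgebra.coe_mul, map_mul, hx, hy, AddMonoidAlgebra.single_mul_single]
    congr 1; push_cast; ring

theorem F_mem_negBorelGrading (D : Set I) (i : I) [Decidable (i ∈ D)] :
    (⟨Uq.F T q i, F_mem_negBorel T q i⟩ : negBorel T q) ∈
      negBorelGrading T q D (if i ∈ D then 1 else 0) := by
  rw [mem_negBorelGrading]
  by_cases h : i ∈ D <;> simp [coaction, chi, h]

theorem K_mem_negBorelGrading (D : Set I) (μ : T.Z) :
    (⟨Uq.K T q μ, K_mem_negBorel T q μ⟩ : negBorel T q) ∈ negBorelGrading T q D 0 := by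
  rw [mem_negBorelGrading]
  simp [coaction]

theorem negBorelGrading_isInternal (D : Set I) :
    DirectSum.IsInternal (negBorelGrading T q D) := by
  classical
  have key : ∀ (f : DirectSum ℕ fun n => negBorelGrading T q D n) (n : ℕ),
      (coaction T q (chi D) (DirectSum.coeAlgHom (negBorelGrading T q D) f : negBorel T q)).coeff
        (-(n : ℤ)) = ((f n : negBorel T q) : Uq T q) := by
    intro f n
    induction f using DirectSum.induction_on with
    | zero => simp
    | of m x =>
      rw [DirectSum.coeAlgHom_of, (mem_negBorelGrading T q).1 x.2, AddMonoidAlgebra.coeff_single,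
        Finsupp.single_apply]
      by_cases h : m = n
      · subst h; simp
      · rw [if_neg (by omega), DirectSum.of_eq_of_ne _ _ _ (Ne.symm h)]; rfl
    | add f g hf hg =>
      rw [map_add, Subalgebra.coe_add, map_add, AddMonoidAlgebra.coeff_add, Finsupp.add_apply, hf, hg]
      rfl
  constructor
  · intro f g hfg
    refine DFinsupp.ext fun n => Subtype.ext (Subtype.ext ?_)
    rw [← key, ← key]
    exact congrArg (fun x : negBorel T q => (coaction T q (chi D) x).coeff (-(n : ℤ))) hfg
  · rintro ⟨x, hx⟩
    change ⟨x, hx⟩ ∈ (DirectSum.coeAlgHom (negBorelGrading T q D)).range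
    induction hx using Algebra.adjoin_induction with
    | mem x hx =>
      rcases hx with ⟨i, rfl⟩ | ⟨μ, rfl⟩
      · exact ⟨DirectSum.of (fun n => negBorelGrading T q D n) _
          ⟨_, F_mem_negBorelGrading T q D i⟩, DirectSum.coeAlgHom_of _ _ _⟩
      · exact ⟨DirectSum.of (fun n => negBorelGrading T q D n) _
          ⟨_, K_mem_negBorelGrading T q D μ⟩, DirectSum.coeAlgHom_of _ _ _⟩
    | algebraMap r => exact Subalgebra.algebraMap_mem _ r
    | add x y _ _ hx hy => exact add_mem hx hy
    | mul x y _ _ hx hy => exact mul_mem hx hy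

noncomputable instance (D : Set I) : GradedAlgebra (negBorelGrading T q D) :=
  (negBorelGrading_isInternal T q D).gradedAlgebra

end Grading

section Coinvariants
variable {H : Type*} [Ring H] [HopfAlgebra k H] (𝒜 : ℕ → Submodule k H) [GradedAlgebra 𝒜]

/-- The projection `π : H → H₀` of an `ℕ`-graded algebra. -/
noncomputable def projZero : H →ₐ[k] 𝒜 0 :=
  { GradedRing.projZeroRingHom' 𝒜 with
    commutes' := fun r => by
      apply Subtype.ext
      change ((GradedRing.projZeroRingHom' 𝒜 (algebraMap k H r) : 𝒜 0) : H) = algebraMap k H r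
      rw [GradedRing.coe_projZeroRingHom'_apply, GradedRing.projZeroRingHom_apply,
        DirectSum.decompose_of_mem_same 𝒜 (SetLike.algebraMap_mem_graded 𝒜 r)] }

/-- `B = {b ∈ H | b₍₁₎ ⊗ π(b₍₂₎) = b ⊗ 1}`, the subalgebra of coinvariants of `H`. -/
noncomputable def coinvariants : Subalgebra k H :=
  AlgHom.equalizer
    ((Algebra.TensorProduct.map (AlgHom.id k H) (projZero 𝒜)).comp (Bialgebra.comulAlgHom k H))
    (Algebra.TensorProduct.includeLeft : H →ₐ[k] H ⊗[k] 𝒜 0)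

/-- `B_n = B ∩ H_n`, as a subspace of `B`. -/
noncomputable def coinvariantsGrading (n : ℕ) : Submodule k (coinvariants 𝒜) :=
  (𝒜 n).comap (coinvariants 𝒜).val.toLinearMap

end Coinvariants

section Main
variable (T : RootDatum I Y X) {J : Type*} (ι : J → I) (q : QParam k)

/-- The algebra `B = B(𝔗, 𝔍, ι, q)` for a sub-root datum `𝔍 ⊆ 𝔗` via `ι : J → I`: the coinvariants of
the negative Borel subalgebra for the grading attached to `D = I ∖ ι(J)`. Of the sub-root datum, only
`ι` enters the construction. -/
noncomputable def B : Subalgebra k (negBorel T q) :=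
  coinvariants (negBorelGrading T q (Set.range ι)ᶜ)

/-- The homogeneous component `B_n`. -/
noncomputable def BPart (n : ℕ) : Submodule k (B T ι q) :=
  coinvariantsGrading (negBorelGrading T q (Set.range ι)ᶜ) n

/-- The index `|𝔗 : 𝔍|_q = dim B₁`, a cardinal. -/
noncomputable def index : Cardinal := Module.rank k (BPart T ι q 1)

end Main
end Uq
end QEA

/-! Only one implication has content: a finite-dimensional B₁ forces every B_n to be
finite-dimensional. The reason is that B is generated in degree one. Write V = B₁. If B_n ⊆ Vⁿ, the
products of n elements of a finite basis of V span a space containing B_n.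

Let S be the subalgebra of H generated by the K_μ and the F_i with i ∉ D, which all have degree 0.
Three facts give B_n ⊆ Vⁿ. (a) V and S generate H. For i ∈ D the element F_i H_i is coinvariant of
degree 1, and F_i = (F_i H_i) H_i⁻¹. (b) S V ⊆ V S. Coinvariants of each degree are stable under
conjugation by K_μ and under the adjoint action b ↦ (F_i b - b F_i) H_i for i ∉ D
(`zeroGen_mul_mem`). (c) On S the coaction ρ = (id ⊗ π)Δ coincides with Δ, after the inclusion of H₀
in H.

By (a) and (b), H is the sum of the spaces Vⁿ S. Since Vⁿ S has degree n, H_n ⊆ Vⁿ S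
(`graded_le_pow_mul`).

The S-factor is then removed by the map Φ(x) = x₍₀₎ σ(x₍₁₎), where ρ(x) = x₍₀₎ ⊗ x₍₁₎ and σ is the
antipode. It fixes every coinvariant, and it sends w s to ε(s) w for w ∈ Vⁿ and s ∈ S, by (c) and
the antipode axiom. So if b ∈ B_n is written as a sum of terms w s, then b = Φ(b) lies in Vⁿ
(`coinvariantsPart_le_pow`).

The argument is carried out for any graded algebra with a Hopf structure satisfying (a), (b), (c),
and these are then verified on generators of the negative Borel subalgebra. -/

namespace QEA

/-! ### Coinvariants inside H, and the map Φ(x) = x₍₀₎ σ(x₍₁₎) -/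

section CoinvariantsFinite
variable {k : Type*} [Field k] {H : Type*} [Ring H] [HopfAlgebra k H] (𝒜 : ℕ → Submodule k H)
  [GradedAlgebra 𝒜]

/-- The right coaction `b ↦ b₍₁₎ ⊗ π(b₍₂₎)` of `H₀` on `H`. -/
noncomputable def zeroCoaction : H →ₐ[k] H ⊗[k] 𝒜 0 :=
  (Algebra.TensorProduct.map (AlgHom.id k H) (projZero 𝒜)).comp (Bialgebra.comulAlgHom k H)

/-- `B_n`, as a subspace of `H`. -/
noncomputable def coinvariantsPart (n : ℕ) : Submodule k H :=
  Subalgebra.toSubmodule (coinvariants 𝒜) ⊓ 𝒜 n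

theorem mem_coinvariantsPart {n : ℕ} {b : H} :
    b ∈ coinvariantsPart 𝒜 n ↔ zeroCoaction 𝒜 b = b ⊗ₜ[k] 1 ∧ b ∈ 𝒜 n := Iff.rfl

/-- Passes from subspaces of B to subspaces of H, where B_n can be multiplied with elements of
degree 0 that are not coinvariant. -/
theorem map_coinvariantsGrading (n : ℕ) :
    (coinvariantsGrading 𝒜 n).map (coinvariants 𝒜).val.toLinearMap = coinvariantsPart 𝒜 n := by
  ext x
  constructor
  · rintro ⟨y, hy, rfl⟩
    exact ⟨y.2, hy⟩
  · rintro ⟨h1, h2⟩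
    exact ⟨⟨x, h1⟩, h2, rfl⟩

theorem finite_coinvariantsGrading_iff (n : ℕ) :
    Module.Finite k (coinvariantsGrading 𝒜 n) ↔ (coinvariantsPart 𝒜 n).FG := by
  rw [← map_coinvariantsGrading, Module.Finite.iff_fg]
  exact (Submodule.fg_map_iff _ Subtype.val_injective).symm

/-- The map `x ⊗ y ↦ x S(y)`. -/
noncomputable def mulAntipode : H ⊗[k] 𝒜 0 →ₗ[k] H :=
  LinearMap.mul' k H ∘ₗ LinearMap.lTensor H (HopfAlgebra.antipode k ∘ₗ (𝒜 0).subtype)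

/-- For a coinvariant w one has ρ(w) = w ⊗ 1, so this makes Φ linear for left multiplication by
coinvariants. -/
theorem mulAntipode_tmul_mul (w : H) (t : H ⊗[k] 𝒜 0) :
    mulAntipode 𝒜 (w ⊗ₜ 1 * t) = w * mulAntipode 𝒜 t := by
  induction t with
  | zero =>
    exact (congrArg _ (mul_zero (w ⊗ₜ[k] (1 : 𝒜 0)))).trans
      ((map_zero _).trans ((congrArg (w * ·) (map_zero (mulAntipode 𝒜))).trans (mul_zero w)).symm)
  | add a b ha hb => simp only [mul_add, map_add, ha, hb]
  | tmul a b => simp [mulAntipode, mul_assoc]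

theorem mulAntipode_tmul_one (w : H) : mulAntipode 𝒜 (w ⊗ₜ 1) = w := by
  simp [mulAntipode]

/-- Where ρ agrees with Δ, the map Φ is s ↦ s₍₁₎ σ(s₍₂₎), and the antipode axiom evaluates it. -/
theorem mulAntipode_zeroCoaction {s : H}
    (hs : LinearMap.lTensor H (𝒜 0).subtype (zeroCoaction 𝒜 s) = Coalgebra.comul (R := k) s) :
    mulAntipode 𝒜 (zeroCoaction 𝒜 s) = algebraMap k H (Coalgebra.counit s) := by
  rw [mulAntipode, LinearMap.lTensor_comp, LinearMap.comp_apply, LinearMap.comp_apply, hs,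
    HopfAlgebra.mul_antipode_lTensor_comul_apply]

/-! ### Generation of the coinvariants in degree one -/

variable {𝒜} {S : Subalgebra k H}

theorem pow_mul_le_graded (hS : Subalgebra.toSubmodule S ≤ 𝒜 0) (n : ℕ) :
    coinvariantsPart 𝒜 1 ^ n * Subalgebra.toSubmodule S ≤ 𝒜 n := by
  have hp : coinvariantsPart 𝒜 1 ^ n ≤ 𝒜 n := by
    induction n with
    | zero => rw [pow_zero, Submodule.one_le]; exact SetLike.one_mem_graded 𝒜
    | succ n ih =>
      rw [pow_succ, Submodule.mul_le]
      exact fun x hx y hy => SetLike.mul_mem_graded (ih hx) hy.2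
  rw [Submodule.mul_le]
  exact fun x hx y hy => by simpa using SetLike.mul_mem_graded (hp hx) (hS hy)

/-- An element of S is moved to the right past the factors of V one at a time and is finally
absorbed by S · S = S. -/
theorem mul_pow_mul_le
    (hcomm : Subalgebra.toSubmodule S * coinvariantsPart 𝒜 1 ≤
      coinvariantsPart 𝒜 1 * Subalgebra.toSubmodule S) (n : ℕ) :
    Subalgebra.toSubmodule S * (coinvariantsPart 𝒜 1 ^ n * Subalgebra.toSubmodule S) ≤
      coinvariantsPart 𝒜 1 ^ n * Subalgebra.toSubmodule S := by
  induction n with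
  | zero => rw [pow_zero, one_mul, (Subalgebra.isIdempotentElem_toSubmodule S).eq]
  | succ n ih =>
    set V := coinvariantsPart 𝒜 1
    set W := Subalgebra.toSubmodule S
    calc W * (V ^ (n + 1) * W) = W * V * (V ^ n * W) := by rw [pow_succ']; simp only [mul_assoc]
      _ ≤ V * W * (V ^ n * W) := mul_le_mul_left hcomm _
      _ = V * (W * (V ^ n * W)) := mul_assoc _ _ _
      _ ≤ V * (V ^ n * W) := mul_le_mul_right ih _
      _ = V ^ (n + 1) * W := by rw [pow_succ', mul_assoc]

/-- The sum of the Vⁿ S is a left ideal containing 1. -/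
theorem iSup_pow_mul_eq_top
    (hcomm : Subalgebra.toSubmodule S * coinvariantsPart 𝒜 1 ≤
      coinvariantsPart 𝒜 1 * Subalgebra.toSubmodule S)
    (hgen : Algebra.adjoin k ((coinvariantsPart 𝒜 1 : Set H) ∪ S) = ⊤) :
    ⨆ n, coinvariantsPart 𝒜 1 ^ n * Subalgebra.toSubmodule S = ⊤ := by
  set M := ⨆ n, coinvariantsPart 𝒜 1 ^ n * Subalgebra.toSubmodule S with hM
  -- It suffices to multiply by generators of H: a factor from V raises the exponent by one, and a
  -- factor from S preserves each Vⁿ S.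
  have hmul : ∀ x : H, ∀ y ∈ M, x * y ∈ M := by
    intro x
    have hx : x ∈ Algebra.adjoin k ((coinvariantsPart 𝒜 1 : Set H) ∪ S) := by rw [hgen]; trivial
    induction hx using Algebra.adjoin_induction with
    | mem x hx =>
      intro y hy
      rcases hx with hx | hx
      · have : coinvariantsPart 𝒜 1 * M ≤ M := by
          rw [hM, Submodule.mul_iSup]
          refine iSup_le fun n => ?_
          rw [← mul_assoc, ← pow_succ']
          exact le_iSup (fun n => coinvariantsPart 𝒜 1 ^ n * Subalgebra.toSubmodule S) (n + 1)
        exact this (Submodule.mul_mem_mul hx hy)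
      · have : Subalgebra.toSubmodule S * M ≤ M := by
          rw [hM, Submodule.mul_iSup]
          exact iSup_mono fun n => mul_pow_mul_le hcomm n
        exact this (Submodule.mul_mem_mul hx hy)
    | algebraMap r => intro y hy; rw [← Algebra.smul_def]; exact M.smul_mem r hy
    | add a b _ _ ha hb => intro y hy; rw [add_mul]; exact add_mem (ha y hy) (hb y hy)
    | mul a b _ _ ha hb => intro y hy; rw [mul_assoc]; exact ha _ (hb y hy)
  have hone : (1 : H) ∈ M := by
    refine Submodule.mem_iSup_of_mem 0 ?_
    rw [pow_zero, one_mul]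
    exact S.one_mem
  exact eq_top_iff.2 fun x _ => by simpa using hmul x 1 hone

/-- Each V^m S is concentrated in degree m, so the degree-n component of an element of the sum only
sees the summand Vⁿ S. For n = 0 this says that S is all of H₀. -/
theorem graded_le_pow_mul (hS : Subalgebra.toSubmodule S ≤ 𝒜 0)
    (hcomm : Subalgebra.toSubmodule S * coinvariantsPart 𝒜 1 ≤
      coinvariantsPart 𝒜 1 * Subalgebra.toSubmodule S)
    (hgen : Algebra.adjoin k ((coinvariantsPart 𝒜 1 : Set H) ∪ S) = ⊤) (n : ℕ) :
    𝒜 n ≤ coinvariantsPart 𝒜 1 ^ n * Subalgebra.toSubmodule S := by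
  -- Stated for arbitrary elements of the sum, not only homogeneous ones, so that induction on the
  -- sum applies.
  have key : ∀ x ∈ ⨆ n, coinvariantsPart 𝒜 1 ^ n * Subalgebra.toSubmodule S,
      ((DirectSum.decompose 𝒜 x n : 𝒜 n) : H) ∈
        coinvariantsPart 𝒜 1 ^ n * Subalgebra.toSubmodule S := by
    intro x hx
    induction hx using Submodule.iSup_induction' with
    | mem m x hx =>
      by_cases h : m = n
      · subst h
        rwa [DirectSum.decompose_of_mem_same 𝒜 (pow_mul_le_graded hS m hx)]
      · rw [DirectSum.decompose_of_mem_ne 𝒜 (pow_mul_le_graded hS m hx) h]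
        exact zero_mem _
    | zero => simp
    | add x y _ _ hx hy =>
      rw [DirectSum.decompose_add, DirectSum.add_apply, Submodule.coe_add]
      exact add_mem hx hy
  intro x hx
  have := key x (by rw [iSup_pow_mul_eq_top hcomm hgen]; trivial)
  rwa [DirectSum.decompose_of_mem_same 𝒜 hx] at this

/-- The algebra of coinvariants is generated in degree one. -/
theorem coinvariantsPart_le_pow (hS : Subalgebra.toSubmodule S ≤ 𝒜 0)
    (hcoact : ∀ s ∈ S,
      LinearMap.lTensor H (𝒜 0).subtype (zeroCoaction 𝒜 s) = Coalgebra.comul (R := k) s)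
    (hcomm : Subalgebra.toSubmodule S * coinvariantsPart 𝒜 1 ≤
      coinvariantsPart 𝒜 1 * Subalgebra.toSubmodule S)
    (hgen : Algebra.adjoin k ((coinvariantsPart 𝒜 1 : Set H) ∪ S) = ⊤) (n : ℕ) :
    coinvariantsPart 𝒜 n ≤ coinvariantsPart 𝒜 1 ^ n := by
  intro b hb
  -- Products of coinvariants are coinvariant because ρ is an algebra homomorphism.
  have hpow : ∀ w ∈ coinvariantsPart 𝒜 1 ^ n, zeroCoaction 𝒜 w = w ⊗ₜ[k] 1 := by
    have hle : ∀ m, coinvariantsPart 𝒜 1 ^ m ≤ Subalgebra.toSubmodule (coinvariants 𝒜) := by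
      intro m
      induction m with
      | zero => rw [pow_zero, Submodule.one_le]; exact one_mem (coinvariants 𝒜)
      | succ m ih =>
        rw [pow_succ, Submodule.mul_le]
        exact fun x hx y hy => mul_mem (S := Subalgebra k H) (ih hx) hy.1
    exact hle n
  -- Φ(w s) = w Φ(s) = ε(s) w: the map Φ projects Vⁿ S into Vⁿ.
  have key : ∀ x ∈ coinvariantsPart 𝒜 1 ^ n * Subalgebra.toSubmodule S,
      mulAntipode 𝒜 (zeroCoaction 𝒜 x) ∈ coinvariantsPart 𝒜 1 ^ n := by
    intro x hx
    induction hx using Submodule.mul_induction_on' with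
    | mem_mul_mem w hw s hs =>
      rw [map_mul, hpow w hw, mulAntipode_tmul_mul, mulAntipode_zeroCoaction 𝒜 (hcoact s hs),
        ← Algebra.commutes, ← Algebra.smul_def]
      exact Submodule.smul_mem _ _ hw
    | add x _ y _ hx hy => rw [map_add, map_add]; exact add_mem hx hy
  -- Since b is coinvariant, Φ(b) = b, and the membership is one for b itself.
  have := key b (graded_le_pow_mul hS hcomm hgen n hb.2)
  rwa [(mem_coinvariantsPart 𝒜).1 hb |>.1, mulAntipode_tmul_one] at this

/-! ### Reduction of the hypotheses on S to algebra generators -/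

variable (𝒜) in
theorem coe_projZero {x : H} (hx : x ∈ 𝒜 0) : (projZero 𝒜 x : H) = x := by
  change ((GradedRing.projZeroRingHom' 𝒜 x : 𝒜 0) : H) = x
  rw [GradedRing.coe_projZeroRingHom'_apply, GradedRing.projZeroRingHom_apply,
    DirectSum.decompose_of_mem_same 𝒜 hx]

variable (𝒜) in
theorem projZero_of_ne {n : ℕ} (hn : n ≠ 0) {x : H} (hx : x ∈ 𝒜 n) : projZero 𝒜 x = 0 := by
  apply Subtype.ext
  change ((GradedRing.projZeroRingHom' 𝒜 x : 𝒜 0) : H) = 0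
  rw [GradedRing.coe_projZeroRingHom'_apply, GradedRing.projZeroRingHom_apply,
    DirectSum.decompose_of_mem_ne 𝒜 hx hn]

variable (𝒜) in
/-- The inclusion `H ⊗ H₀ → H ⊗ H`. -/
noncomputable def tensorZeroIncl : H ⊗[k] 𝒜 0 →ₐ[k] H ⊗[k] H :=
  Algebra.TensorProduct.map (AlgHom.id k H)
    (AlgHom.ofLinearMap (𝒜 0).subtype rfl fun _ _ => rfl)

/-- Both sides are algebra homomorphisms in s, so the set where they agree is a subalgebra. -/
theorem lTensor_zeroCoaction_of_mem_adjoin {G : Set H}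
    (hG : ∀ s ∈ G,
      LinearMap.lTensor H (𝒜 0).subtype (zeroCoaction 𝒜 s) = Coalgebra.comul (R := k) s)
    {s : H} (hs : s ∈ Algebra.adjoin k G) :
    LinearMap.lTensor H (𝒜 0).subtype (zeroCoaction 𝒜 s) = Coalgebra.comul (R := k) s := by
  have hle : Algebra.adjoin k G ≤ AlgHom.equalizer ((tensorZeroIncl 𝒜).comp (zeroCoaction 𝒜))
      (Bialgebra.comulAlgHom k H) := Algebra.adjoin_le hG
  exact hle hs

theorem toSubmodule_adjoin_le_zero {G : Set H} (hG : G ⊆ 𝒜 0) :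
    Subalgebra.toSubmodule (Algebra.adjoin k G) ≤ 𝒜 0 := by
  intro x hx
  induction hx using Algebra.adjoin_induction with
  | mem x hx => exact hG hx
  | algebraMap r => exact SetLike.algebraMap_mem_graded 𝒜 r
  | add x y _ _ hx hy => exact add_mem hx hy
  | mul x y _ _ hx hy => simpa using SetLike.mul_mem_graded hx hy

/-- The condition is multiplicative: if x and y both carry V into V S, then x y V ⊆ x V S ⊆ V S S =
V S. -/
theorem adjoin_mul_le {G : Set H} {V : Submodule k H}
    (hG : ∀ g ∈ G, ∀ b ∈ V, g * b ∈ V * Subalgebra.toSubmodule (Algebra.adjoin k G)) :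
    Subalgebra.toSubmodule (Algebra.adjoin k G) * V ≤
      V * Subalgebra.toSubmodule (Algebra.adjoin k G) := by
  rw [Submodule.mul_le]
  intro x hx
  induction hx using Algebra.adjoin_induction with
  | mem x hx => exact hG x hx
  | algebraMap r =>
    intro b hb
    rw [Algebra.commutes]
    exact Submodule.mul_mem_mul hb (Subalgebra.algebraMap_mem _ r)
  | add x y _ _ hx hy => intro b hb; rw [add_mul]; exact add_mem (hx b hb) (hy b hb)
  | mul x y _ _ hx hy =>
    intro b hb
    -- The induction hypothesis for x concerns V only; it is extended to V S because y b is known to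
    -- lie there.
    have hxV : ∀ z ∈ V * Subalgebra.toSubmodule (Algebra.adjoin k G),
        x * z ∈ V * Subalgebra.toSubmodule (Algebra.adjoin k G) := by
      intro z hz
      induction hz using Submodule.mul_induction_on' with
      | mem_mul_mem v hv s hs =>
        have := Submodule.mul_mem_mul (hx v hv) hs
        rwa [mul_assoc V, (Subalgebra.isIdempotentElem_toSubmodule _).eq, mul_assoc] at this
      | add z _ w _ hz hw => rw [mul_add]; exact add_mem hz hw
    rw [mul_assoc]
    exact hxV _ (hy b hb)

/-! ### Coinvariants from grouplike and skew-primitive elements -/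

section Skew
variable (𝒜) in
theorem tmul_mul_tmul_zero (a b : H) (c d : 𝒜 0) :
    (a ⊗ₜ[k] c * b ⊗ₜ[k] d : H ⊗[k] 𝒜 0) = (a * b) ⊗ₜ[k] (c * d) := by
  simp

variable {g g' f : H}

theorem zeroCoaction_of_comul_eq_tmul_self (hg : Coalgebra.comul (R := k) g = g ⊗ₜ g) :
    zeroCoaction 𝒜 g = g ⊗ₜ projZero 𝒜 g := by
  simp [zeroCoaction, hg]

theorem zeroCoaction_of_comul_eq_add (hf : Coalgebra.comul (R := k) f = f ⊗ₜ g' + 1 ⊗ₜ f) :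
    zeroCoaction 𝒜 f = f ⊗ₜ projZero 𝒜 g' + 1 ⊗ₜ projZero 𝒜 f := by
  simp [zeroCoaction, hf]

theorem lTensor_zeroCoaction_of_comul_eq_tmul_self (hg0 : g ∈ 𝒜 0)
    (hg : Coalgebra.comul (R := k) g = g ⊗ₜ g) :
    LinearMap.lTensor H (𝒜 0).subtype (zeroCoaction 𝒜 g) = Coalgebra.comul (R := k) g := by
  rw [zeroCoaction_of_comul_eq_tmul_self hg, hg, LinearMap.lTensor_tmul, Submodule.subtype_apply,
    coe_projZero 𝒜 hg0]

theorem lTensor_zeroCoaction_of_comul_eq_add (hf0 : f ∈ 𝒜 0) (hg'0 : g' ∈ 𝒜 0)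
    (hf : Coalgebra.comul (R := k) f = f ⊗ₜ g' + 1 ⊗ₜ f) :
    LinearMap.lTensor H (𝒜 0).subtype (zeroCoaction 𝒜 f) = Coalgebra.comul (R := k) f := by
  rw [zeroCoaction_of_comul_eq_add hf, hf, map_add, LinearMap.lTensor_tmul, LinearMap.lTensor_tmul,
    Submodule.subtype_apply, Submodule.subtype_apply, coe_projZero 𝒜 hf0, coe_projZero 𝒜 hg'0]

/-- As f has positive degree, π(f) = 0 and ρ(f) = f ⊗ π(g'). The right factor g cancels π(g'), since
π is multiplicative and g' g = 1. -/
theorem mul_mem_coinvariantsPart {n : ℕ} (hn : n ≠ 0) (hfn : f ∈ 𝒜 n) (hg0 : g ∈ 𝒜 0)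
    (hgg' : g' * g = 1) (hg : Coalgebra.comul (R := k) g = g ⊗ₜ g)
    (hf : Coalgebra.comul (R := k) f = f ⊗ₜ g' + 1 ⊗ₜ f) :
    f * g ∈ coinvariantsPart 𝒜 n := by
  refine (mem_coinvariantsPart _).2 ⟨?_, ?_⟩
  · rw [map_mul, zeroCoaction_of_comul_eq_add hf, zeroCoaction_of_comul_eq_tmul_self hg,
      projZero_of_ne 𝒜 hn hfn, TensorProduct.tmul_zero, add_zero,
      tmul_mul_tmul_zero, ← map_mul, hgg', map_one]
  · simpa using SetLike.mul_mem_graded hfn hg0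

/-- The second tensor factor of ρ(g b g') is π(g) π(g') = π(g g') = 1. -/
theorem conj_mem_coinvariantsPart {n : ℕ} {b : H} (hg0 : g ∈ 𝒜 0) (hg'0 : g' ∈ 𝒜 0)
    (hgg' : g * g' = 1) (hg : Coalgebra.comul (R := k) g = g ⊗ₜ g)
    (hg' : Coalgebra.comul (R := k) g' = g' ⊗ₜ g') (hb : b ∈ coinvariantsPart 𝒜 n) :
    g * b * g' ∈ coinvariantsPart 𝒜 n := by
  obtain ⟨hb1, hb2⟩ := (mem_coinvariantsPart _).1 hb
  refine (mem_coinvariantsPart _).2 ⟨?_, ?_⟩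
  · rw [map_mul, map_mul, zeroCoaction_of_comul_eq_tmul_self hg,
      zeroCoaction_of_comul_eq_tmul_self hg', hb1, tmul_mul_tmul_zero,
      tmul_mul_tmul_zero, mul_one, ← map_mul, hgg', map_one]
  · simpa using SetLike.mul_mem_graded (SetLike.mul_mem_graded hg0 hb2) hg'0

/-- The element is the adjoint action f₍₁₎ b σ(f₍₂₎), as σ(g') = g and σ(f) = -f g. Both ρ(f b) and
ρ(b f) contain the term b ⊗ π(f), which cancels in the commutator; what remains is the commutator
tensored with π(g'), and g removes π(g'). -/
theorem adjoint_mem_coinvariantsPart {n : ℕ} {b : H} (hf0 : f ∈ 𝒜 0) (hg0 : g ∈ 𝒜 0)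
    (hgg' : g' * g = 1) (hg : Coalgebra.comul (R := k) g = g ⊗ₜ g)
    (hf : Coalgebra.comul (R := k) f = f ⊗ₜ g' + 1 ⊗ₜ f) (hb : b ∈ coinvariantsPart 𝒜 n) :
    (f * b - b * f) * g ∈ coinvariantsPart 𝒜 n := by
  obtain ⟨hb1, hb2⟩ := (mem_coinvariantsPart _).1 hb
  refine (mem_coinvariantsPart _).2 ⟨?_, ?_⟩
  · have hf' := zeroCoaction_of_comul_eq_add (𝒜 := 𝒜) hf
    have h1 : zeroCoaction 𝒜 (f * b) =
        (f * b) ⊗ₜ projZero 𝒜 g' + b ⊗ₜ projZero 𝒜 f := by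
      rw [map_mul, hf', hb1, add_mul, tmul_mul_tmul_zero, tmul_mul_tmul_zero, one_mul, mul_one,
        mul_one]
    have h2 : zeroCoaction 𝒜 (b * f) =
        (b * f) ⊗ₜ projZero 𝒜 g' + b ⊗ₜ projZero 𝒜 f := by
      rw [map_mul, hf', hb1, mul_add, tmul_mul_tmul_zero, tmul_mul_tmul_zero, one_mul, mul_one,
        one_mul]
    rw [map_mul, map_sub, h1, h2, add_sub_add_right_eq_sub, ← TensorProduct.sub_tmul,
      zeroCoaction_of_comul_eq_tmul_self hg, tmul_mul_tmul_zero, ← map_mul, hgg', map_one]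
  · have h1 := SetLike.mul_mem_graded hf0 hb2
    have h2 := SetLike.mul_mem_graded hb2 hf0
    rw [zero_add] at h1
    rw [add_zero] at h2
    simpa using SetLike.mul_mem_graded (sub_mem h1 h2) hg0

end Skew

/-- If the coinvariants are generated in degree one, then their homogeneous components are
finite-dimensional as soon as the one of degree one is. -/
theorem finite_coinvariantsGrading_iff_rank_lt
    (hle : ∀ n, coinvariantsPart 𝒜 n ≤ coinvariantsPart 𝒜 1 ^ n) :
    (∀ n, Module.Finite k (coinvariantsGrading 𝒜 n)) ↔
      Module.rank k (coinvariantsGrading 𝒜 1) < Cardinal.aleph0 := by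
  rw [Module.rank_lt_aleph0_iff]
  refine ⟨fun h => h 1, fun h1 n => ?_⟩
  -- A power of a finitely generated subspace is finitely generated, and over a field this passes to
  -- the subspace B_n.
  have hfin : Module.Finite k ↥(coinvariantsPart 𝒜 1 ^ n) :=
    Module.Finite.iff_fg.2 (((finite_coinvariantsGrading_iff 𝒜 1).1 h1).pow n)
  exact (finite_coinvariantsGrading_iff 𝒜 n).2
    (Module.Finite.iff_fg.1 (Submodule.finiteDimensional_of_le (hle n)))

end CoinvariantsFinite

/-! ### Generators and coproduct of the negative Borel subalgebra -/

section NegBorelCoinvariants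
variable {k : Type*} [Field k] {I Y X : Type*} [AddCommGroup Y] [AddCommGroup X]
variable (T : RootDatum I Y X) (q : QParam k)

namespace negBorel

/-- `F_i` in the negative Borel subalgebra. -/
noncomputable def F (i : I) : negBorel T q := ⟨Uq.F T q i, F_mem_negBorel T q i⟩

/-- `K_μ` in the negative Borel subalgebra. -/
noncomputable def K (μ : T.Z) : negBorel T q := ⟨Uq.K T q μ, K_mem_negBorel T q μ⟩

/-- `H_i` in the negative Borel subalgebra. -/
noncomputable def H (i : I) : negBorel T q := K T q (T.c i • T.z i)

/-- `H_i⁻¹` in the negative Borel subalgebra. -/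
noncomputable def Hinv (i : I) : negBorel T q := K T q (-(T.c i • T.z i))

theorem K_mul_K_neg (μ : T.Z) : K T q μ * K T q (-μ) = 1 :=
  Subtype.ext ((Uq.relations T q).K_mul_neg μ)

theorem K_neg_mul_K (μ : T.Z) : K T q (-μ) * K T q μ = 1 :=
  Subtype.ext ((Uq.relations T q).K_neg_mul μ)

theorem H_mul_Hinv (i : I) : H T q i * Hinv T q i = 1 := K_mul_K_neg T q _

theorem Hinv_mul_H (i : I) : Hinv T q i * H T q i = 1 := K_neg_mul_K T q _

/-- With the injectivity of `subIncl₂`, this lets coproducts in the subalgebra be computed in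
U_q(𝔗), where they are given on generators. -/
theorem subIncl₂_comul (x : negBorel T q) :
    subIncl₂ (negBorel T q) (Coalgebra.comul (R := k) x) = Uq.comulHom T q x :=
  (negBorel_isSubHopf T q).incl_comulHom x

theorem comul_F (i : I) :
    Coalgebra.comul (R := k) (F T q i) = F T q i ⊗ₜ Hinv T q i + 1 ⊗ₜ F T q i := by
  apply subIncl₂_injective
  rw [subIncl₂_comul]
  simp [subIncl₂, Uq.comulHom, F, Hinv, K, Uq.Hinv]

theorem comul_K (μ : T.Z) : Coalgebra.comul (R := k) (K T q μ) = K T q μ ⊗ₜ K T q μ := by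
  apply subIncl₂_injective
  rw [subIncl₂_comul]
  simp [subIncl₂, Uq.comulHom, K]

theorem adjoin_F_K : Algebra.adjoin k (Set.range (F T q) ∪ Set.range (K T q)) = ⊤ := by
  rw [eq_top_iff]
  rintro ⟨x, hx⟩ -
  induction hx using Algebra.adjoin_induction with
  | mem x hx =>
    rcases hx with ⟨i, rfl⟩ | ⟨μ, rfl⟩
    · exact Algebra.subset_adjoin (Or.inl ⟨i, rfl⟩)
    · exact Algebra.subset_adjoin (Or.inr ⟨μ, rfl⟩)
  | algebraMap r => exact Subalgebra.algebraMap_mem _ r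
  | add x y _ _ hx hy => exact add_mem hx hy
  | mul x y _ _ hx hy => exact mul_mem hx hy

/-! ### Degree-zero generators and coinvariants of the negative Borel subalgebra -/

variable (D : Set I)

theorem K_mem_zero (μ : T.Z) : K T q μ ∈ negBorelGrading T q D 0 := K_mem_negBorelGrading T q D μ

variable {D}

theorem F_mem_zero {i : I} (h : i ∉ D) : F T q i ∈ negBorelGrading T q D 0 := by
  classical
  have := F_mem_negBorelGrading T q D i
  rwa [if_neg h] at this

theorem F_mem_one {i : I} (h : i ∈ D) : F T q i ∈ negBorelGrading T q D 1 := by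
  classical
  have := F_mem_negBorelGrading T q D i
  rwa [if_pos h] at this

variable (D)

/-- The generators `K_μ` and `F_i`, `i ∉ D`, of degree zero. -/
def zeroGen : Set (negBorel T q) := Set.range (K T q) ∪ F T q '' Dᶜ

theorem zeroGen_subset : zeroGen T q D ⊆ negBorelGrading T q D 0 := by
  rintro _ (⟨μ, rfl⟩ | ⟨i, hi, rfl⟩)
  · exact K_mem_zero T q D μ
  · exact F_mem_zero T q hi

theorem lTensor_zeroCoaction_of_mem_zeroGen {s : negBorel T q} (hs : s ∈ zeroGen T q D) :
    LinearMap.lTensor _ (negBorelGrading T q D 0).subtype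
      (zeroCoaction (negBorelGrading T q D) s) = Coalgebra.comul (R := k) s := by
  rcases hs with ⟨μ, rfl⟩ | ⟨i, hi, rfl⟩
  · exact lTensor_zeroCoaction_of_comul_eq_tmul_self (K_mem_zero T q D μ) (comul_K T q μ)
  · exact lTensor_zeroCoaction_of_comul_eq_add (F_mem_zero T q hi) (K_mem_zero T q D _)
      (comul_F T q i)

variable {D}

/-- Here ρ(F_i) = F_i ⊗ H_i⁻¹, so the factor H_i is what makes F_i coinvariant. -/
theorem F_mul_H_mem {i : I} (hi : i ∈ D) :
    F T q i * H T q i ∈ coinvariantsPart (negBorelGrading T q D) 1 :=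
  mul_mem_coinvariantsPart one_ne_zero (F_mem_one T q hi) (K_mem_zero T q D _)
    (Hinv_mul_H T q i) (comul_K T q _) (comul_F T q i)

theorem K_conj_mem (μ : T.Z) {n : ℕ} {b : negBorel T q}
    (hb : b ∈ coinvariantsPart (negBorelGrading T q D) n) :
    K T q μ * b * K T q (-μ) ∈ coinvariantsPart (negBorelGrading T q D) n :=
  conj_mem_coinvariantsPart (K_mem_zero T q D _) (K_mem_zero T q D _) (K_mul_K_neg T q μ)
    (comul_K T q _) (comul_K T q _) hb

theorem F_adjoint_mem {i : I} (hi : i ∉ D) {n : ℕ} {b : negBorel T q}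
    (hb : b ∈ coinvariantsPart (negBorelGrading T q D) n) :
    (F T q i * b - b * F T q i) * H T q i ∈ coinvariantsPart (negBorelGrading T q D) n :=
  adjoint_mem_coinvariantsPart (F_mem_zero T q hi) (K_mem_zero T q D _) (Hinv_mul_H T q i)
    (comul_K T q _) (comul_F T q i) hb

/-- A generator of degree 0 passes to the right of b at the cost of replacing b by its image under
the adjoint action, which is again coinvariant of the same degree. -/
theorem zeroGen_mul_mem {s : negBorel T q} (hs : s ∈ zeroGen T q D) {n : ℕ} {b : negBorel T q}
    (hb : b ∈ coinvariantsPart (negBorelGrading T q D) n) :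
    s * b ∈ coinvariantsPart (negBorelGrading T q D) n *
      Subalgebra.toSubmodule (Algebra.adjoin k (zeroGen T q D)) := by
  have hK : ∀ μ, K T q μ ∈ Algebra.adjoin k (zeroGen T q D) :=
    fun μ => Algebra.subset_adjoin (Or.inl ⟨μ, rfl⟩)
  rcases hs with ⟨μ, rfl⟩ | ⟨i, hi, rfl⟩
  · have : K T q μ * b = K T q μ * b * K T q (-μ) * K T q μ := by
      rw [mul_assoc, K_neg_mul_K, mul_one]
    rw [this]
    exact Submodule.mul_mem_mul (K_conj_mem T q μ hb) (hK μ)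
  -- The commutator is the adjoint action of F_i on b followed by H_i⁻¹, and H_i⁻¹ belongs to S,
  -- being some K_μ.
  · have : F T q i * b =
        (F T q i * b - b * F T q i) * H T q i * Hinv T q i + b * F T q i := by
      rw [mul_assoc, H_mul_Hinv, mul_one, sub_add_cancel]
    rw [this]
    exact add_mem (Submodule.mul_mem_mul (F_adjoint_mem T q hi hb) (hK _))
      (Submodule.mul_mem_mul hb (Algebra.subset_adjoin (Or.inr ⟨i, hi, rfl⟩)))

variable (D)

/-- Only the F_i with i ∈ D are missing from S, and they are recovered as (F_i H_i) H_i⁻¹. -/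
theorem adjoin_coinvariantsPart_one :
    Algebra.adjoin k ((coinvariantsPart (negBorelGrading T q D) 1 : Set (negBorel T q)) ∪
      Algebra.adjoin k (zeroGen T q D)) = ⊤ := by
  rw [eq_top_iff, ← adjoin_F_K]
  apply Algebra.adjoin_le
  have h0 : ∀ s ∈ zeroGen T q D,
      s ∈ Algebra.adjoin k ((coinvariantsPart (negBorelGrading T q D) 1 : Set (negBorel T q)) ∪
        Algebra.adjoin k (zeroGen T q D)) :=
    fun s hs => Algebra.subset_adjoin (Or.inr (Algebra.subset_adjoin hs))
  rintro _ (⟨i, rfl⟩ | ⟨μ, rfl⟩)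
  · by_cases hi : i ∈ D
    · have : F T q i = F T q i * H T q i * Hinv T q i := by rw [mul_assoc, H_mul_Hinv, mul_one]
      rw [this]
      exact mul_mem (Algebra.subset_adjoin (Or.inl (F_mul_H_mem T q hi))) (h0 _ (Or.inl ⟨_, rfl⟩))
    · exact h0 _ (Or.inr ⟨i, hi, rfl⟩)
  · exact h0 _ (Or.inl ⟨μ, rfl⟩)

/-- The general criterion applied to S generated by `zeroGen`. -/
theorem coinvariantsPart_le_pow (n : ℕ) : coinvariantsPart (negBorelGrading T q D) n ≤
    coinvariantsPart (negBorelGrading T q D) 1 ^ n :=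
  QEA.coinvariantsPart_le_pow (toSubmodule_adjoin_le_zero (zeroGen_subset T q D))
    (fun _ => lTensor_zeroCoaction_of_mem_adjoin
      fun _ hs => lTensor_zeroCoaction_of_mem_zeroGen T q D hs)
    (adjoin_mul_le fun _ hs _ hb => zeroGen_mul_mem T q hs hb)
    (adjoin_coinvariantsPart_one T q D) n

end negBorel

end NegBorelCoinvariants
end QEA

theorem mainTheorem10 {k : Type*} [Field k] {I Y X J Y' X' : Type*}
    [AddCommGroup Y] [AddCommGroup X] [AddCommGroup Y'] [AddCommGroup X']
    (𝔗 : QEA.RootDatum I Y X) (𝔍 : QEA.RootDatum J Y' X') (ι : J → I)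
    (h : QEA.IsSubRootDatum 𝔍 𝔗 ι) (q : QEA.QParam k) :
    (∀ n : ℕ, FiniteDimensional k (QEA.BPart 𝔗 ι q n)) ↔
      QEA.index 𝔗 ι q < Cardinal.aleph0 := by
  -- `BPart` and `index` unfold to the general notions for D = I ∖ ι(J).
  exact QEA.finite_coinvariantsGrading_iff_rank_lt
    (QEA.negBorel.coinvariantsPart_le_pow 𝔗 q (Set.range ι)ᶜ)
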